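/- Let $p_1<p_2<\cdots$ be a strictly increasing sequence of prime numbers, let $K=\mathbb{Q}(\sqrt{p_1},\sqrt{p_2},\ldots)\subset\mathbb{R}$, and let $G=\bigoplus_{i\ge 1}\mathbb{Z}$ with standard generators $x_1,x_2,\ldots$, ordered lexicographically ($x<y$ if $x$ has the smaller entry at the first index where $x$ and $y$ differ). There is a group homomorphism $\Phi\colon G\to\mathrm{Aut}(K)=\mathrm{Gal}(K/\mathbb{Q})$, $x\mapsto\Phi_x$, with $\Phi_{x_i}(\sqrt{p_i})=-\sqrt{p_i}$ and $\Phi_{x_i}(\sqrt{p_j})=\sqrt{p_j}$ for all $i$ and all $j\neq i$. Let $K((G,\Phi))$ be the division ring of formal series $\sum_{x\in G}a_x x$ with $a_x\in K$ and well-ordered support, with termwise addition and the multiplication $$\Big(\sum_x a_x x\Big)\Big(\sum_y b_y y\Big)=\sum_z\Big(\sum_{x+y=z}a_x\,\Phi_x(b_y)\Big)z .$$ Then there is a division subring $R$ of $K((G,\Phi))$ such that (1) $R$ is weakly locally finite: for every finite subset $S\subseteq R$, the division subring of $R$ generated by $S$ is finite-dimensional over its own center; (2) $R$, as an algebra over its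 center $F=Z(R)$, has Gelfand–Kirillov dimension one, that is, $$\sup_V\ \limsup_{r\to\infty}\ \log_r\dim_F V^r=1,$$ where $V$ ranges over the finite-dimensional $F$-subspaces of $R$ containing $1$, and $V^r$ is the $F$-span of all products of $r$ elements of $V$; (3) $R$ is not algebraic over its center. In particular, there exists a weakly locally finite division ring of Gelfand–Kirillov dimension one that is not algebraic over its center. -/

import Mathlib

/-! ### Twisted Malcev–Neumann series -/

/-- The set `K((Γ, Φ))` of formal sums `∑ a_x x` (`x ∈ Γ`, `a_x ∈ K`) with well-ordered support,
where `Γ` is a totally ordered abelian group (written additively) acting on `K` by ring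
automorphisms through `Φ`. -/
@[ext]
structure MalcevNeumann {Γ K : Type*} [AddCommGroup Γ] [LinearOrder Γ] [Ring K]
    (Φ : Multiplicative Γ →* RingAut K) where
  /-- The coefficient `a_x` of `x`. -/
  coeff : Γ → K
  /-- The support is well-ordered. -/
  isWF_support : (Function.support coeff).IsWF

namespace MalcevNeumann

section Additive

variable {Γ K : Type*} [AddCommGroup Γ] [LinearOrder Γ] [Ring K]
  {Φ : Multiplicative Γ →* RingAut K}

theorem isPWO_support (a : MalcevNeumann Φ) : (Function.support a.coeff).IsPWO :=
  Set.isPWO_iff_isWF.2 a.isWF_support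

instance : Zero (MalcevNeumann Φ) :=
  ⟨⟨fun _ => 0, by simp⟩⟩

open scoped Classical in
/-- The series `c x` with a single term. -/
noncomputable def single (x : Γ) (c : K) : MalcevNeumann Φ :=
  ⟨fun y => if y = x then c else 0, by
    refine ((Set.finite_singleton x).subset ?_).isWF
    intro y hy
    by_contra h
    exact hy (if_neg h)⟩

noncomputable instance : One (MalcevNeumann Φ) := ⟨single 0 1⟩

instance : Add (MalcevNeumann Φ) :=
  ⟨fun a b => ⟨fun x => a.coeff x + b.coeff x,
    (a.isWF_support.union b.isWF_support).mono (Function.support_add _ _)⟩⟩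

instance : Neg (MalcevNeumann Φ) :=
  ⟨fun a => ⟨fun x => -a.coeff x, by
    have h : (Function.support fun x => -a.coeff x) = Function.support a.coeff := by
      ext x; simp
    rw [h]; exact a.isWF_support⟩⟩

@[simp] theorem coeff_zero (x : Γ) : (0 : MalcevNeumann Φ).coeff x = 0 := rfl

@[simp] theorem coeff_add (a b : MalcevNeumann Φ) (x : Γ) :
    (a + b).coeff x = a.coeff x + b.coeff x := rfl

@[simp] theorem coeff_neg (a : MalcevNeumann Φ) (x : Γ) : (-a).coeff x = -a.coeff x := rfl

open scoped Classical in
theorem coeff_single (x y : Γ) (c : K) :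
    (single x c : MalcevNeumann Φ).coeff y = if y = x then c else 0 := rfl

theorem one_def : (1 : MalcevNeumann Φ) = single 0 1 := rfl

end Additive

section Ring

variable {Γ K : Type*} [AddCommGroup Γ] [LinearOrder Γ] [IsOrderedAddMonoid Γ] [Ring K]
  {Φ : Multiplicative Γ →* RingAut K}

open scoped Pointwise in
/-- The product is `(∑ a_x x) (∑ b_y y) = ∑_z (∑_{x + y = z} a_x Φ_x(b_y)) z`; the inner sum runs
over the finitely many pairs with `x` in the support of `a` and `y` in the support of `b`. -/
noncomputable instance : Mul (MalcevNeumann Φ) :=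
  ⟨fun a b =>
    ⟨fun z => ∑ ij ∈ Finset.antidiagonal a.isPWO_support b.isPWO_support z,
        a.coeff ij.1 * Φ (Multiplicative.ofAdd ij.1) (b.coeff ij.2), by
      refine (Set.isPWO_iff_isWF.1 (a.isPWO_support.add b.isPWO_support)).mono ?_
      intro z hz
      obtain ⟨ij, hij, -⟩ := Finset.exists_ne_zero_of_sum_ne_zero hz
      rw [Finset.mem_antidiagonal] at hij
      exact ⟨ij.1, hij.1, ij.2, hij.2.1, hij.2.2⟩⟩⟩

theorem coeff_mul (a b : MalcevNeumann Φ) (z : Γ) :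
    (a * b).coeff z = ∑ ij ∈ Finset.antidiagonal a.isPWO_support b.isPWO_support z,
      a.coeff ij.1 * Φ (Multiplicative.ofAdd ij.1) (b.coeff ij.2) := rfl

/-- In the formula for the product, the supports may be enlarged. -/
theorem coeff_mul_of_subset {s t : Set Γ} (hs : s.IsPWO) (ht : t.IsPWO) (a b : MalcevNeumann Φ)
    (has : Function.support a.coeff ⊆ s) (hbt : Function.support b.coeff ⊆ t) (z : Γ) :
    (a * b).coeff z = ∑ ij ∈ Finset.antidiagonal hs ht z,
      a.coeff ij.1 * Φ (Multiplicative.ofAdd ij.1) (b.coeff ij.2) := by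
  rw [coeff_mul]
  refine Finset.sum_subset ?_ ?_
  · intro ij hij
    rw [Finset.mem_antidiagonal] at hij ⊢
    exact ⟨has hij.1, hbt hij.2.1, hij.2.2⟩
  · intro ij hij hn
    rw [Finset.mem_antidiagonal] at hij hn
    by_cases h1 : a.coeff ij.1 = 0
    · rw [h1, zero_mul]
    · by_cases h2 : b.coeff ij.2 = 0
      · rw [h2, map_zero, mul_zero]
      · exact absurd ⟨h1, h2, hij.2.2⟩ hn

open scoped Pointwise in
theorem support_mul_subset (a b : MalcevNeumann Φ) :
    Function.support (a * b).coeff ⊆ Function.support a.coeff + Function.support b.coeff := by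
  intro z hz
  obtain ⟨ij, hij, -⟩ := Finset.exists_ne_zero_of_sum_ne_zero hz
  rw [Finset.mem_antidiagonal] at hij
  exact ⟨ij.1, hij.1, ij.2, hij.2.1, hij.2.2⟩

open scoped Pointwise in
protected theorem mul_assoc (a b c : MalcevNeumann Φ) : a * b * c = a * (b * c) := by
  ext z
  rw [coeff_mul_of_subset (a.isPWO_support.add b.isPWO_support) c.isPWO_support _ _
      (support_mul_subset a b) subset_rfl,
    coeff_mul_of_subset a.isPWO_support (b.isPWO_support.add c.isPWO_support) _ _
      subset_rfl (support_mul_subset b c)]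
  simp only [coeff_mul, map_sum, Finset.sum_mul, Finset.mul_sum, Finset.sum_sigma']
  refine Finset.sum_nbij' (fun p => ⟨(p.2.1, p.2.2 + p.1.2), (p.2.2, p.1.2)⟩)
    (fun p => ⟨(p.1.1 + p.2.1, p.2.2), (p.1.1, p.2.1)⟩) ?_ ?_ ?_ ?_ ?_
  · rintro ⟨⟨i, j⟩, ⟨k, l⟩⟩ h
    simp only [Finset.mem_sigma, Finset.mem_antidiagonal] at h ⊢
    obtain ⟨⟨-, hj, rfl⟩, hk, hl, rfl⟩ := h
    exact ⟨⟨hk, Set.add_mem_add hl hj, (add_assoc _ _ _).symm⟩, hl, hj, by trivial⟩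
  · rintro ⟨⟨i, j⟩, ⟨k, l⟩⟩ h
    simp only [Finset.mem_sigma, Finset.mem_antidiagonal] at h ⊢
    obtain ⟨⟨hi, -, rfl⟩, hk, hl, rfl⟩ := h
    exact ⟨⟨Set.add_mem_add hi hk, hl, add_assoc _ _ _⟩, hi, hk, by trivial⟩
  · rintro ⟨⟨i, j⟩, ⟨k, l⟩⟩ h
    simp only [Finset.mem_sigma, Finset.mem_antidiagonal] at h
    obtain ⟨-, -, -, rfl⟩ := h
    rfl
  · rintro ⟨⟨i, j⟩, ⟨k, l⟩⟩ h
    simp only [Finset.mem_sigma, Finset.mem_antidiagonal] at h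
    obtain ⟨-, -, -, rfl⟩ := h
    rfl
  · rintro ⟨⟨i, j⟩, ⟨k, l⟩⟩ h
    simp only [Finset.mem_sigma, Finset.mem_antidiagonal] at h
    obtain ⟨-, -, -, rfl⟩ := h
    simp [ofAdd_add, mul_assoc]

theorem coeff_single_mul (x : Γ) (c : K) (a : MalcevNeumann Φ) (z : Γ) :
    (single x c * a).coeff z = c * Φ (Multiplicative.ofAdd x) (a.coeff (z - x)) := by
  classical
  have hsub : Function.support (single x c : MalcevNeumann Φ).coeff ⊆ {x} := by
    intro y hy
    by_contra h
    exact hy (if_neg h)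
  rw [coeff_mul_of_subset (Set.isPWO_singleton x) a.isPWO_support _ _ hsub subset_rfl,
    Finset.sum_eq_single (x, z - x)]
  · simp [coeff_single]
  · rintro ⟨i, j⟩ h hne
    rw [Finset.mem_antidiagonal] at h
    obtain ⟨h1, -, h3⟩ := h
    obtain rfl : i = x := h1
    exact absurd (by rw [← (h3 : i + j = z), add_sub_cancel_left]) hne
  · intro h
    have h0 : a.coeff (z - x) = 0 := by
      by_contra h1
      exact h (Finset.mem_antidiagonal.2 ⟨rfl, h1, add_sub_cancel _ _⟩)
    simp [h0]

theorem coeff_mul_single (x : Γ) (c : K) (a : MalcevNeumann Φ) (z : Γ) :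
    (a * single x c).coeff z = a.coeff (z - x) * Φ (Multiplicative.ofAdd (z - x)) c := by
  classical
  have hsub : Function.support (single x c : MalcevNeumann Φ).coeff ⊆ {x} := by
    intro y hy
    by_contra h
    exact hy (if_neg h)
  rw [coeff_mul_of_subset a.isPWO_support (Set.isPWO_singleton x) _ _ subset_rfl hsub,
    Finset.sum_eq_single (z - x, x)]
  · simp [coeff_single]
  · rintro ⟨i, j⟩ h hne
    rw [Finset.mem_antidiagonal] at h
    obtain ⟨-, h2, h3⟩ := h
    obtain rfl : j = x := h2
    exact absurd (by rw [← (h3 : i + j = z), add_sub_cancel_right]) hne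
  · intro h
    have h0 : a.coeff (z - x) = 0 := by
      by_contra h1
      exact h (Finset.mem_antidiagonal.2 ⟨h1, rfl, sub_add_cancel _ _⟩)
    simp [h0]

/-- `K((Γ, Φ))` is a ring. -/
noncomputable instance instRing : Ring (MalcevNeumann Φ) where
  add_assoc a b c := by ext; simp [add_assoc]
  zero_add a := by ext; simp
  add_zero a := by ext; simp
  add_comm a b := by ext; simp [add_comm]
  neg_add_cancel a := by ext; simp
  nsmul := nsmulRec
  zsmul := zsmulRec
  mul_assoc := MalcevNeumann.mul_assoc
  one_mul a := by ext z; rw [one_def, coeff_single_mul]; simp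
  mul_one a := by ext z; rw [one_def, coeff_mul_single]; simp
  zero_mul a := by
    ext z; rw [coeff_mul]; exact Finset.sum_eq_zero fun _ _ => zero_mul _
  mul_zero a := by
    ext z; rw [coeff_mul]
    exact Finset.sum_eq_zero fun _ _ => by rw [coeff_zero, map_zero, mul_zero]
  left_distrib a b c := by
    ext z
    have h := (b.isPWO_support.union c.isPWO_support)
    rw [coeff_add,
      coeff_mul_of_subset a.isPWO_support h a (b + c) subset_rfl (Function.support_add _ _),
      coeff_mul_of_subset a.isPWO_support h a b subset_rfl Set.subset_union_left,
      coeff_mul_of_subset a.isPWO_support h a c subset_rfl Set.subset_union_right,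
      ← Finset.sum_add_distrib]
    simp [mul_add]
  right_distrib a b c := by
    ext z
    have h := (a.isPWO_support.union b.isPWO_support)
    rw [coeff_add,
      coeff_mul_of_subset h c.isPWO_support (a + b) c (Function.support_add _ _) subset_rfl,
      coeff_mul_of_subset h c.isPWO_support a c Set.subset_union_left subset_rfl,
      coeff_mul_of_subset h c.isPWO_support b c Set.subset_union_right subset_rfl,
      ← Finset.sum_add_distrib]
    simp [add_mul]

end Ring

section DivisionRing

variable {Γ K : Type*} [AddCommGroup Γ] [LinearOrder Γ] [IsOrderedAddMonoid Γ] [DivisionRing K]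
  {Φ : Multiplicative Γ →* RingAut K}

instance : Nontrivial (MalcevNeumann Φ) := by
  refine ⟨0, 1, fun h => ?_⟩
  have h1 : (0 : MalcevNeumann Φ).coeff 0 = (1 : MalcevNeumann Φ).coeff 0 := by rw [← h]
  rw [one_def, coeff_single, if_pos rfl, coeff_zero] at h1
  exact zero_ne_one h1

/-- A series `1 - u` with `u` supported in positive elements has a left inverse. -/
theorem exists_mul_one_sub (u : MalcevNeumann Φ) (hu : ∀ x, u.coeff x ≠ 0 → 0 < x) :
    ∃ b : MalcevNeumann Φ, b * (1 - u) = 1 := by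
  classical
  set M : Set Γ := (AddSubmonoid.closure (Function.support u.coeff) : Set Γ) with hM
  have hMpwo : M.IsPWO :=
    Set.IsPWO.addSubmonoid_closure (fun x hx => (hu x hx).le) u.isPWO_support
  have hwf : WellFounded ((· < ·) : M → M → Prop) := hMpwo.isWF
  let F : ∀ x : M, (∀ y : M, y < x → K) → K := fun x ih =>
    (if (x : Γ) = 0 then 1 else 0) +
      ∑ ij ∈ (Finset.antidiagonal hMpwo u.isPWO_support (x : Γ)).attach,
        ih ⟨ij.1.1, (Finset.mem_antidiagonal.1 ij.2).1⟩ (by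
            have h := Finset.mem_antidiagonal.1 ij.2
            have h2 := hu _ h.2.1
            change ij.1.1 < (x : Γ)
            exact (lt_add_of_pos_right _ h2).trans_eq h.2.2) *
          Φ (Multiplicative.ofAdd ij.1.1) (u.coeff ij.1.2)
  let g : M → K := hwf.fix F
  have hg : ∀ x : M, g x = (if (x : Γ) = 0 then 1 else 0) +
      ∑ ij ∈ (Finset.antidiagonal hMpwo u.isPWO_support (x : Γ)).attach,
        g ⟨ij.1.1, (Finset.mem_antidiagonal.1 ij.2).1⟩ *
          Φ (Multiplicative.ofAdd ij.1.1) (u.coeff ij.1.2) := fun x => hwf.fix_eq F x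
  let f : Γ → K := fun x => if h : x ∈ M then g ⟨x, h⟩ else 0
  have hf : Function.support f ⊆ M := by
    intro x hx
    by_contra h
    exact hx (dif_neg h)
  let b : MalcevNeumann Φ := ⟨f, hMpwo.isWF.mono hf⟩
  refine ⟨b, ?_⟩
  have hb : b = 1 + b * u := by
    ext z
    rw [coeff_add, coeff_mul_of_subset hMpwo u.isPWO_support b u hf subset_rfl, one_def,
      coeff_single]
    by_cases hz : z ∈ M
    · have h1 : b.coeff z = g ⟨z, hz⟩ := dif_pos hz
      rw [h1, hg, ← Finset.sum_attach (Finset.antidiagonal hMpwo u.isPWO_support z)]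
      refine congrArg₂ _ rfl (Finset.sum_congr rfl fun ij _ => ?_)
      have h2 : b.coeff ij.1.1 = g ⟨ij.1.1, (Finset.mem_antidiagonal.1 ij.2).1⟩ := dif_pos _
      rw [h2]
    · have h1 : b.coeff z = 0 := dif_neg hz
      have h0 : z ≠ 0 := by
        rintro rfl
        exact hz (zero_mem (AddSubmonoid.closure (Function.support u.coeff)))
      rw [h1, if_neg h0, zero_add, Finset.sum_eq_zero]
      intro ij hij
      rw [Finset.mem_antidiagonal] at hij
      refine absurd ?_ hz
      rw [← hij.2.2]
      exact add_mem (S := AddSubmonoid Γ) hij.1 (AddSubmonoid.subset_closure hij.2.1)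
  rw [mul_sub, mul_one, sub_eq_iff_eq_add]
  exact hb

/-- Every nonzero series has a left inverse. -/
theorem exists_mul_eq_one (a : MalcevNeumann Φ) (ha : a ≠ 0) : ∃ b, b * a = 1 := by
  have hne : (Function.support a.coeff).Nonempty := by
    by_contra h
    rw [Set.not_nonempty_iff_eq_empty, Function.support_eq_empty_iff] at h
    exact ha (MalcevNeumann.ext h)
  set m : Γ := a.isWF_support.min hne with hm
  have hma : a.coeff m ≠ 0 := a.isWF_support.min_mem hne
  have hmin : ∀ x, a.coeff x ≠ 0 → m ≤ x := fun x hx => a.isWF_support.min_le hne hx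
  set s : MalcevNeumann Φ := single (-m) (Φ (Multiplicative.ofAdd (-m)) (a.coeff m))⁻¹ with hs
  obtain ⟨b, hb⟩ := exists_mul_one_sub (1 - s * a) (by
    intro x hx
    have hne0 : Φ (Multiplicative.ofAdd (-m)) (a.coeff m) ≠ 0 := by simpa using hma
    have hc : (1 - s * a).coeff x = (1 : MalcevNeumann Φ).coeff x - (s * a).coeff x := by
      rw [sub_eq_add_neg, coeff_add, coeff_neg, sub_eq_add_neg]
    rw [hc, one_def, hs, coeff_single_mul, coeff_single, sub_neg_eq_add] at hx
    rcases lt_trichotomy x 0 with h | h | h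
    · exfalso
      apply hx
      have h0 : a.coeff (x + m) = 0 := by
        by_contra h1
        have := hmin _ h1
        exact absurd this (not_le.2 (by simpa using h))
      rw [if_neg h.ne, h0, map_zero, mul_zero, sub_zero]
    · exfalso
      apply hx
      rw [h, if_pos rfl, zero_add, inv_mul_cancel₀ hne0, sub_self]
    · exact h)
  refine ⟨b * s, ?_⟩
  rw [mul_assoc]
  simpa using hb

/-- `K((Γ, Φ))` is a division ring when `K` is one. -/
noncomputable instance instDivisionRing : DivisionRing (MalcevNeumann Φ) :=
  DivisionRing.ofIsUnitOrEqZero fun a => by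
    by_cases ha : a = 0
    · exact Or.inr ha
    · left
      obtain ⟨b, hb⟩ := exists_mul_eq_one a ha
      have hb0 : b ≠ 0 := by
        rintro rfl
        rw [zero_mul] at hb
        exact zero_ne_one hb
      obtain ⟨c, hc⟩ := exists_mul_eq_one b hb0
      have hca : c = a := by
        rw [← mul_one c, ← hb, ← mul_assoc, hc, one_mul]
      exact ⟨⟨a, b, by rw [← hca]; exact hc, hb⟩, rfl⟩

end DivisionRing

end MalcevNeumann

/-! ### Finiteness conditions on division rings -/

/-- A division ring is centrally finite if it is finite-dimensional over its center. -/
def IsCentrallyFinite (D : Type*) [DivisionRing D] : Prop :=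
  Module.Finite (Subring.center D) D

/-- A division ring is weakly locally finite if every finite subset generates a centrally finite
division subring. (`Subfield` is Mathlib's name for a division subring.) -/
def IsWeaklyLocallyFinite (D : Type*) [DivisionRing D] : Prop :=
  ∀ S : Set D, S.Finite → IsCentrallyFinite (Subfield.closure S)

open Filter in
/-- The Gelfand–Kirillov dimension of a `k`-algebra `A`: the supremum of
`limsup_{r → ∞} log_r (dim_k V ^ r)` over all finite-dimensional subspaces `V` of `A` that
contain `1`. Here `V ^ r` is the span of all products of `r` elements of `V`. -/
noncomputable def gkDim (k A : Type*) [Field k] [Ring A] [Algebra k A] : EReal :=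
  ⨆ (V : Submodule k A) (_ : Module.Finite k V) (_ : (1 : A) ∈ V),
    limsup (fun r : ℕ => ((Real.logb r (Module.finrank k (V ^ r : Submodule k A)) : ℝ) : EReal))
      atTop

/-- The Gelfand–Kirillov dimension of a division ring, as an algebra over its center. -/
noncomputable def divisionRingGKDim (D : Type*) [DivisionRing D] : EReal :=
  gkDim (Subring.center D) D

/-! ### The field and the ordered group -/

/-- The subfield `ℚ(√p₀, √p₁, …)` of `ℝ`. -/
noncomputable abbrev SqrtField (p : ℕ → ℕ) : IntermediateField ℚ ℝ :=
  IntermediateField.adjoin ℚ (Set.range fun i => √(p i : ℝ))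

/-- The element `√pᵢ` of `ℚ(√p₀, √p₁, …)`. -/
noncomputable def sqrtElem (p : ℕ → ℕ) (i : ℕ) : SqrtField p :=
  ⟨√(p i : ℝ), IntermediateField.subset_adjoin ℚ _ ⟨i, rfl⟩⟩

/-- The direct sum of countably many copies of `ℤ`, with the lexicographic order: `x < y` if
`x k < y k` at the first index `k` where `x` and `y` differ. -/
abbrev LexSum : Type := Lex (ℕ →₀ ℤ)

/-- The `i`-th standard generator of the direct sum. -/
noncomputable def lexGen (i : ℕ) : LexSum := toLex (Finsupp.single i 1)

/-! `R` is generated as a division ring by the x_i, the √p_i and t_0 = ∑ x_i⁻¹; the last is a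
legitimate series because the x_i decrease, so their inverses increase. Let F be the center of `R`.
The squares x_i² and p_i are central, x_i anticommutes with √p_i, and all other pairs of these
generators commute, so the first n pairs generate a finite-dimensional F-algebra B_n. The tail t_n =
∑_{i≥n} x_i⁻¹ commutes with B_n and differs from t_0 by an element of B_n.

The tail t_n is transcendental over F: conjugation by √p_i with i ≥ n turns it into t_n − 2x_i⁻¹,
and a polynomial over F killing t_n would kill all these commuting conjugates
(`transcendental_of_infinite_conjugates`). In particular `R` is not algebraic.

Since B_n[t_n] is a finite module over F[t_n], inverting the nonzero elements of F[t_n] gives a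
division ring B_n(t_n) (`fracSubfield`). These increase with n and have union `R`, so any finite set
lies in one of them. A division subring E of B_n(t_n) commutes with F[t_n]; hence, up to a common
denominator, a family in E independent over Z(E) is independent over F[t_n], and its size is bounded
by the rank of B_n[t_n] (`isCentrallyFinite_of_le_fracSubfield`). For the dimension, one denominator
Q clears a finite-dimensional V, so V^r Q^r consists of polynomials in t_n of degree O(r) and growth
is at most linear (`exists_finrank_pow_le`); the span of 1 and t_0 already grows linearly.

The action exists because each √p_i lies outside the field generated by the others, so Galois theory
provides the sign changes. -/

/-! ### Linear independence over the center and over the centralizer -/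

section CentralIndependence

variable {D : Type*} [DivisionRing D] {E : Subfield D}

theorem Subfield.center_smul_def (c : Subring.center E) (x : D) : c • x = ((c : E) : D) * x := rfl

/-- Elements commuting with `E` that are independent over the center of `E` are independent
over `E`. -/
theorem Subfield.eq_zero_of_sum_mul_eq_zero {ι : Type*} {b : ι → D}
    (hb : LinearIndependent (Subring.center E) b) (hcomm : ∀ i, ∀ x : E, Commute (x : D) (b i))
    (s : Finset ι) : ∀ e : ι → E, ∑ i ∈ s, (e i : D) * b i = 0 → ∀ i ∈ s, e i = 0 := by
  classical
  induction s using Finset.induction_on with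
  | empty => simp
  | insert a s ha ih =>
    intro e h
    by_cases hea : e a = 0
    · rw [Finset.sum_insert ha, hea, ZeroMemClass.coe_zero, zero_mul, zero_add] at h
      intro i hi
      rcases Finset.mem_insert.1 hi with rfl | hi
      · exact hea
      · exact ih e h i hi
    exfalso
    -- Shortest-relation argument: with the coefficient of `b a` normalized to 1, the commutator of
    -- the relation with any `x` in `E` has no `b a` term, so induction forces the other
    -- coefficients to be central.
    set f : ι → E := fun i => (e a)⁻¹ * e i with hf
    have hfa : f a = 1 := inv_mul_cancel₀ hea
    have hsum : b a + ∑ i ∈ s, (f i : D) * b i = 0 := by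
      have h1 : ∑ i ∈ insert a s, (f i : D) * b i = 0 := by
        have := congrArg (fun z => (((e a)⁻¹ : E) : D) * z) h
        simp only [Finset.mul_sum, mul_zero] at this
        rw [← this]
        exact Finset.sum_congr rfl fun i _ => by simp [hf, mul_assoc]
      rw [Finset.sum_insert ha, hfa] at h1
      simpa using h1
    have hcen : ∀ i ∈ s, f i ∈ Subring.center E := by
      intro i hi
      rw [Subring.mem_center_iff]
      intro x
      have h2 : ∑ i ∈ s, (((x * f i - f i * x : E)) : D) * b i = 0 := by
        have h3 := congrArg (fun z => (x : D) * z - z * x) hsum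
        simp only [mul_add, add_mul, Finset.mul_sum, Finset.sum_mul, mul_zero, zero_mul,
          sub_zero] at h3
        rw [(hcomm a x).eq, add_sub_add_left_eq_sub, ← Finset.sum_sub_distrib] at h3
        rw [← h3]
        refine Finset.sum_congr rfl fun j _ => ?_
        push_cast
        rw [sub_mul, mul_assoc (f j : D) (b j), ← (hcomm j x).eq, mul_assoc, mul_assoc]
      exact sub_eq_zero.1 (ih (fun i => x * f i - f i * x) h2 i hi)
    set g : ι → Subring.center E := fun i => if h : i ∈ s then ⟨f i, hcen i h⟩ else 1 with hg
    have h4 : ∑ i ∈ insert a s, g i • b i = 0 := by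
      rw [Finset.sum_insert ha, ← hsum]
      congr 1
      · simp [hg, ha]
      · exact Finset.sum_congr rfl fun i hi => by simp [hg, hi, Subfield.center_smul_def]
    have h5 := linearIndependent_iff'.1 hb _ g h4 a (Finset.mem_insert_self _ _)
    simp [hg, ha] at h5

/-- Elements of `E` that are independent over the center of `E` are independent over the
centralizer of `E`. -/
theorem Subfield.eq_zero_of_sum_mul_commute_eq_zero {ι : Type*} [Fintype ι] {e : ι → E}
    (he : LinearIndependent (Subring.center E) e) {c : ι → D}
    (hcomm : ∀ i, ∀ x : E, Commute (x : D) (c i)) (h : ∑ i, (e i : D) * c i = 0) (i : ι) :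
    c i = 0 := by
  classical
  -- The `c i` may be dependent over the center; expanding them in a basis of their span, which
  -- still commutes with `E`, reduces to the previous lemma.
  set W : Submodule (Subring.center E) D := Submodule.span _ (Set.range c) with hW
  have hWc : ∀ w ∈ W, ∀ x : E, Commute (x : D) w := by
    intro w hw x
    induction hw using Submodule.span_induction with
    | mem w hw => obtain ⟨i, rfl⟩ := hw; exact hcomm i x
    | zero => exact Commute.zero_right _
    | add w v _ _ hw hv => exact hw.add_right hv
    | smul r w _ hw =>
      rw [Subfield.center_smul_def]
      refine Commute.mul_right ?_ hw
      exact congrArg Subtype.val (Subring.mem_center_iff.1 r.2 x)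
  have : Module.Finite (Subring.center E) W :=
    Module.Finite.span_of_finite _ (Set.finite_range c)
  let b := Module.finBasis (Subring.center E) W
  have hcW : ∀ i, c i ∈ W := fun i => Submodule.subset_span ⟨i, rfl⟩
  let l : ι → _ → Subring.center E := fun i => b.repr ⟨c i, hcW i⟩
  have hl : ∀ i, c i = ∑ j, l i j • (b j : D) := fun i => by
    have := congrArg W.subtype (b.sum_repr ⟨c i, hcW i⟩)
    simp only [map_sum, map_smul] at this
    exact this.symm
  have hb : LinearIndependent (Subring.center E) fun j => (b j : D) :=
    b.linearIndependent.map' W.subtype (Submodule.ker_subtype _)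
  have hsum : ∑ j, (((∑ i, e i * (l i j : E) : E)) : D) * b j = 0 := by
    rw [← h]
    simp only [hl, Finset.mul_sum]
    rw [Finset.sum_comm]
    refine Finset.sum_congr rfl fun j _ => ?_
    push_cast
    rw [Finset.sum_mul]
    exact Finset.sum_congr rfl fun i _ => by rw [Subfield.center_smul_def, mul_assoc]
  have key : ∀ j, ∑ i, l i j • e i = 0 := fun j => by
    have := Subfield.eq_zero_of_sum_mul_eq_zero hb (fun j => hWc _ (b j).2) Finset.univ _ hsum j
      (Finset.mem_univ _)
    rw [← this]
    refine Finset.sum_congr rfl fun i _ => ?_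
    exact ((Subring.mem_center_iff.1 (l i j).2) (e i)).symm
  rw [hl i]
  refine Finset.sum_eq_zero fun j _ => ?_
  rw [linearIndependent_iff'.1 he Finset.univ (fun i => l i j) (key j) i (Finset.mem_univ _),
    zero_smul]

end CentralIndependence

open Polynomial in
/-- An element of a domain annihilated by a nonzero polynomial is annihilated by one with nonzero
constant coefficient. -/
theorem exists_aeval_eq_zero_coeff_zero_ne_zero {R A : Type*} [CommRing R] [IsDomain R] [Ring A]
    [NoZeroDivisors A] [Algebra R A] {a : A} (ha : a ≠ 0) (h : IsAlgebraic R a) :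
    ∃ q : R[X], aeval a q = 0 ∧ q.coeff 0 ≠ 0 := by
  obtain ⟨p, hp, hpa⟩ := h
  obtain ⟨q, hq, hdvd⟩ := exists_eq_pow_rootMultiplicity_mul_and_not_dvd p hp 0
  refine ⟨q, ?_, ?_⟩
  · rw [hq, map_mul, map_pow, C_0, sub_zero, aeval_X] at hpa
    exact (mul_eq_zero.1 hpa).resolve_left (pow_ne_zero _ ha)
  · rwa [C_0, sub_zero, X_dvd_iff] at hdvd

/-! ### The rings B[t] and B(t) for t commuting with a finite-dimensional B -/

section CentralPolynomialExtension

open Polynomial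

variable {k D : Type*} [Field k] [DivisionRing D] [Algebra k D]

/-- The elements `∑_{i ≤ d} t ^ i b_i` with `b_i ∈ B`. -/
def polyFiltration (B : Subalgebra k D) (t : D) (d : ℕ) : Submodule k D :=
  Submodule.span k {z | ∃ i ≤ d, ∃ b ∈ B, z = t ^ i * b}

variable {B : Subalgebra k D} {t : D}

theorem pow_mul_mem_polyFiltration {i d : ℕ} (h : i ≤ d) {b : D} (hb : b ∈ B) :
    t ^ i * b ∈ polyFiltration B t d :=
  Submodule.subset_span ⟨i, h, b, hb, rfl⟩

theorem polyFiltration_mono : Monotone (polyFiltration B t) := fun _ _ h =>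
  Submodule.span_mono fun _ ⟨i, hi, hz⟩ => ⟨i, hi.trans h, hz⟩

theorem one_mem_polyFiltration (d : ℕ) : (1 : D) ∈ polyFiltration B t d := by
  simpa using pow_mul_mem_polyFiltration (t := t) (Nat.zero_le d) (one_mem B)

theorem polyFiltration_mul_le (ht : ∀ b ∈ B, Commute b t) (d e : ℕ) :
    polyFiltration B t d * polyFiltration B t e ≤ polyFiltration B t (d + e) := by
  rw [polyFiltration, polyFiltration, Submodule.span_mul_span, Submodule.span_le]
  rintro _ ⟨_, ⟨i, hi, b, hb, rfl⟩, _, ⟨j, hj, c, hc, rfl⟩, rfl⟩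
  have h : t ^ i * b * (t ^ j * c) = t ^ (i + j) * (b * c) := by
    rw [mul_assoc, ← mul_assoc b, ((ht b hb).pow_right j).eq, pow_add]
    simp only [mul_assoc]
  change t ^ i * b * (t ^ j * c) ∈ polyFiltration B t (d + e)
  rw [h]
  exact pow_mul_mem_polyFiltration (add_le_add hi hj) (mul_mem hb hc)

/-- The linear map from coefficient vectors to `polyFiltration`. -/
noncomputable def polyFiltrationMap (B : Subalgebra k D) (t : D) (d : ℕ) :
    (Fin (d + 1) → B) →ₗ[k] D :=
  ∑ i : Fin (d + 1), (LinearMap.mulLeft k (t ^ (i : ℕ)) ∘ₗ B.val.toLinearMap) ∘ₗ LinearMap.proj i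

/-- Only upper bounds on dimensions are drawn from this, so no independence of the powers of `t`
over `B` is needed. -/
theorem polyFiltration_le_range (d : ℕ) :
    polyFiltration B t d ≤ LinearMap.range (polyFiltrationMap B t d) := by
  classical
  rw [polyFiltration, Submodule.span_le]
  rintro _ ⟨i, hi, b, hb, rfl⟩
  refine ⟨Pi.single ⟨i, Nat.lt_succ_of_le hi⟩ ⟨b, hb⟩, ?_⟩
  rw [polyFiltrationMap, LinearMap.sum_apply, Finset.sum_eq_single ⟨i, Nat.lt_succ_of_le hi⟩]
  · simp
  · intro j _ hj
    simp [Pi.single_eq_of_ne hj]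
  · simp

instance finite_polyFiltration [Module.Finite k B] (d : ℕ) :
    Module.Finite k (polyFiltration B t d) :=
  Submodule.finiteDimensional_of_le (polyFiltration_le_range d)

theorem finrank_polyFiltration_le [Module.Finite k B] (d : ℕ) :
    Module.finrank k (polyFiltration B t d) ≤ (d + 1) * Module.finrank k B := by
  refine (Submodule.finrank_mono (polyFiltration_le_range d)).trans ?_
  refine (LinearMap.finrank_range_le _).trans ?_
  rw [Module.finrank_pi_fintype]
  simp

variable (ht : ∀ b ∈ B, Commute b t)

/-- The subalgebra `B[t]` generated by `B` and an element `t` commuting with `B`. -/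
def polySubalgebra (ht : ∀ b ∈ B, Commute b t) : Subalgebra k D where
  carrier := {z | ∃ d, z ∈ polyFiltration B t d}
  mul_mem' := fun ⟨d, hd⟩ ⟨e, he⟩ =>
    ⟨d + e, polyFiltration_mul_le ht d e (Submodule.mul_mem_mul hd he)⟩
  add_mem' := fun ⟨d, hd⟩ ⟨e, he⟩ =>
    ⟨max d e, add_mem (polyFiltration_mono (le_max_left _ _) hd)
      (polyFiltration_mono (le_max_right _ _) he)⟩
  algebraMap_mem' r := ⟨0, by
    simpa using pow_mul_mem_polyFiltration (t := t) (le_refl 0) (B.algebraMap_mem r)⟩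

theorem le_polySubalgebra : B ≤ polySubalgebra ht := fun b hb =>
  ⟨0, by simpa using pow_mul_mem_polyFiltration (t := t) (le_refl 0) hb⟩

theorem self_mem_polySubalgebra : t ∈ polySubalgebra ht :=
  ⟨1, by simpa using pow_mul_mem_polyFiltration (t := t) (le_refl 1) (one_mem B)⟩

theorem polySubalgebra_le {S : Subalgebra k D} (hB : B ≤ S) (hS : t ∈ S) :
    polySubalgebra ht ≤ S := by
  rintro z ⟨d, hd⟩
  refine (Submodule.span_le (p := Subalgebra.toSubmodule S)).2 ?_ hd
  rintro _ ⟨i, -, b, hb, rfl⟩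
  exact S.mul_mem (pow_mem hS i) (hB hb)

theorem aeval_mem_polySubalgebra (q : k[X]) : aeval t q ∈ polySubalgebra ht := by
  have := aeval_algHom_apply (polySubalgebra ht).val ⟨t, self_mem_polySubalgebra ht⟩ q
  rw [show aeval t q = _ from this]
  exact Subtype.property _

/-- `t` commutes with `B` and with itself, hence is central in B[t]. This is what makes k[t] usable
as a set of denominators. -/
theorem commute_aeval_of_mem_polySubalgebra {z : D} (hz : z ∈ polySubalgebra ht) (q : k[X]) :
    Commute z (aeval t q) := by
  have h : Commute z t := by
    have : polySubalgebra ht ≤ Subalgebra.centralizer k {t} := by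
      refine polySubalgebra_le ht (fun b hb => ?_) ?_
      · rw [Subalgebra.mem_centralizer_iff]
        rintro _ rfl
        exact (ht b hb).eq.symm
      · rw [Subalgebra.mem_centralizer_iff]
        rintro _ rfl
        rfl
    exact (((Subalgebra.mem_centralizer_iff k).1 (this hz)) t rfl).symm
  have h2 : Algebra.adjoin k {t} ≤ Subalgebra.centralizer k {z} := by
    refine Algebra.adjoin_le ?_
    rintro _ rfl
    refine (Subalgebra.mem_centralizer_iff k).2 ?_
    rintro _ rfl
    exact h.eq
  exact ((Subalgebra.mem_centralizer_iff k).1 (h2 (aeval_mem_adjoin_singleton k t))) z rfl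

/-- `B[t]` as an algebra over the polynomial ring. -/
@[reducible]
noncomputable def polySubalgebraAlgebra : Algebra k[X] (polySubalgebra ht) :=
  RingHom.toAlgebra'
    (aeval (⟨t, self_mem_polySubalgebra ht⟩ : polySubalgebra ht) : k[X] →ₐ[k] _).toRingHom
    fun q z => Subtype.ext (by
      have h := commute_aeval_of_mem_polySubalgebra ht z.2 q
      have h2 := aeval_algHom_apply (polySubalgebra ht).val ⟨t, self_mem_polySubalgebra ht⟩ q
      change ((aeval (⟨t, self_mem_polySubalgebra ht⟩ : polySubalgebra ht) q : _) : D) * z =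
        z * ((aeval (⟨t, self_mem_polySubalgebra ht⟩ : polySubalgebra ht) q : _) : D)
      have h3 : ((aeval (⟨t, self_mem_polySubalgebra ht⟩ : polySubalgebra ht) q :
        polySubalgebra ht) : D) = aeval t q := h2.symm
      rw [h3]
      exact h.eq.symm)

theorem coe_polySubalgebra_algebraMap (q : k[X]) :
    letI := polySubalgebraAlgebra ht
    ((algebraMap k[X] (polySubalgebra ht) q : polySubalgebra ht) : D) = aeval t q :=
  (aeval_algHom_apply (polySubalgebra ht).val
    (⟨t, self_mem_polySubalgebra ht⟩ : polySubalgebra ht) q).symm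

theorem coe_polySubalgebra_smul (q : k[X]) (z : polySubalgebra ht) :
    letI := polySubalgebraAlgebra ht
    ((q • z : polySubalgebra ht) : D) = aeval t q * z := by
  let _ := polySubalgebraAlgebra ht
  rw [Algebra.smul_def, MulMemClass.coe_mul, coe_polySubalgebra_algebraMap]

theorem finite_polySubalgebra [Module.Finite k B] :
    letI := polySubalgebraAlgebra ht
    Module.Finite k[X] (polySubalgebra ht) := by
  let _ := polySubalgebraAlgebra ht
  let b := Module.finBasis k B
  let w : Fin _ → polySubalgebra ht := fun i => ⟨b i, le_polySubalgebra ht (b i).2⟩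
  have hB : ∀ x : B, (⟨x, le_polySubalgebra ht x.2⟩ : polySubalgebra ht) ∈
      Submodule.span k[X] (Set.range w) := by
    intro x
    have hx : (⟨x, le_polySubalgebra ht x.2⟩ : polySubalgebra ht) =
        ∑ i, (C (b.repr x i) : k[X]) • w i := by
      apply Subtype.ext
      rw [AddSubmonoidClass.coe_finsetSum]
      simp only [coe_polySubalgebra_smul, aeval_C]
      have := congrArg (fun y : B => (y : D)) (b.sum_repr x)
      refine this.symm.trans ?_
      simp [Algebra.smul_def, w]
    rw [hx]
    exact Submodule.sum_mem _ fun i _ => Submodule.smul_mem _ _ (Submodule.subset_span ⟨i, rfl⟩)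
  refine ⟨Submodule.fg_def.2 ⟨Set.range w, Set.finite_range w, ?_⟩⟩
  rw [eq_top_iff]
  rintro ⟨z, d, hd⟩ -
  have key : ∀ z ∈ polyFiltration B t d, ∃ y ∈ Submodule.span k[X] (Set.range w), (y : D) = z := by
    intro z hz
    induction hz using Submodule.span_induction with
    | mem z hz =>
      obtain ⟨i, -, b, hb, rfl⟩ := hz
      exact ⟨(X ^ i : k[X]) • (⟨b, le_polySubalgebra ht hb⟩ : polySubalgebra ht),
        Submodule.smul_mem _ _ (hB ⟨b, hb⟩), by
        rw [coe_polySubalgebra_smul]; simp⟩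
    | zero => exact ⟨0, zero_mem _, rfl⟩
    | add x y _ _ hx hy =>
      obtain ⟨x', hx, rfl⟩ := hx
      obtain ⟨y', hy, rfl⟩ := hy
      exact ⟨x' + y', add_mem hx hy, rfl⟩
    | smul r x _ hx =>
      obtain ⟨x', hx, rfl⟩ := hx
      exact ⟨(C r : k[X]) • x', Submodule.smul_mem _ _ hx, by
        rw [coe_polySubalgebra_smul, aeval_C, Algebra.smul_def]⟩
  obtain ⟨y, hy, hyz⟩ := key z hd
  exact (Subtype.ext hyz : y = ⟨z, d, hd⟩) ▸ hy

/-- When `B` is finite-dimensional, nonzero elements of `B[t]` divide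
values at `t` of nonzero polynomials. -/
theorem exists_mul_eq_aeval [Module.Finite k B] {a : D}
    (ha : a ∈ polySubalgebra ht) (ha0 : a ≠ 0) :
    ∃ b ∈ polySubalgebra ht, ∃ q : k[X], q ≠ 0 ∧ a * b = aeval t q := by
  let _ := polySubalgebraAlgebra ht
  have := finite_polySubalgebra ht
  obtain ⟨p, hp, hp0⟩ := exists_aeval_eq_zero_coeff_zero_ne_zero
    (R := k[X]) (a := (⟨a, ha⟩ : polySubalgebra ht))
    (fun h => ha0 (congrArg Subtype.val h)) (IsIntegral.of_finite k[X] _).isAlgebraic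
  -- Writing p = X · `p.divX` + p(0), the equation p(a) = 0 reads a · `p.divX`(a) = −p(0), and p(0)
  -- is a nonzero element of `k[X]`.
  refine ⟨_, (aeval (⟨a, ha⟩ : polySubalgebra ht) p.divX).2, -p.coeff 0, neg_ne_zero.2 hp0, ?_⟩
  have h := congrArg Subtype.val hp
  rw [← p.X_mul_divX_add] at h
  simp only [map_add, map_mul, aeval_X, aeval_C, AddMemClass.coe_add, MulMemClass.coe_mul,
    coe_polySubalgebra_algebraMap, ZeroMemClass.coe_zero] at h
  rw [map_neg]
  exact eq_neg_of_add_eq_zero_left h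

theorem aeval_ne_zero_of_transcendental (htr : Transcendental k t) {q : k[X]} (hq : q ≠ 0) :
    aeval t q ≠ 0 := fun h => hq ((transcendental_iff.1 htr) q h)

/-- The division subring `B(t)` of fractions with numerator in `B[t]` and denominator in `k[t]`. -/
def fracSubfield [Module.Finite k B] (ht : ∀ b ∈ B, Commute b t) (htr : Transcendental k t) :
    Subfield D where
  carrier := {z | ∃ q : k[X], q ≠ 0 ∧ z * aeval t q ∈ polySubalgebra ht}
  one_mem' := ⟨1, one_ne_zero, by simp⟩
  zero_mem' := ⟨1, one_ne_zero, by simp⟩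
  mul_mem' := by
    rintro x y ⟨q, hq, hx⟩ ⟨r, hr, hy⟩
    refine ⟨r * q, mul_ne_zero hr hq, ?_⟩
    have h := (commute_aeval_of_mem_polySubalgebra ht hy q).eq
    have : x * y * aeval t (r * q) = (x * aeval t q) * (y * aeval t r) := by
      rw [map_mul, ← mul_assoc, mul_assoc x, mul_assoc x, h, mul_assoc]
    rw [this]
    exact mul_mem hx hy
  add_mem' := by
    rintro x y ⟨q, hq, hx⟩ ⟨r, hr, hy⟩
    refine ⟨q * r, mul_ne_zero hq hr, ?_⟩
    have : (x + y) * aeval t (q * r) =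
        x * aeval t q * aeval t r + y * aeval t r * aeval t q := by
      rw [add_mul, map_mul, ← mul_assoc, mul_assoc y (aeval t r), ← map_mul, ← map_mul,
        mul_comm r q]
    rw [this]
    exact add_mem (mul_mem hx (aeval_mem_polySubalgebra ht _))
      (mul_mem hy (aeval_mem_polySubalgebra ht _))
  neg_mem' := by
    rintro x ⟨q, hq, hx⟩
    exact ⟨q, hq, by rw [neg_mul]; exact neg_mem hx⟩
  inv_mem' := by
    rintro x ⟨q, hq, hx⟩
    by_cases hx0 : x = 0
    · exact ⟨1, one_ne_zero, by simp [hx0]⟩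
    -- With Q = q(t), the numerator xQ satisfies (xQ)b = r(t), whence x⁻¹ r(t) = Qb lies in B[t].
    obtain ⟨b, hb, r, hr, h⟩ := exists_mul_eq_aeval ht hx
      (mul_ne_zero hx0 (aeval_ne_zero_of_transcendental htr hq))
    refine ⟨r, hr, ?_⟩
    rw [← h, mul_assoc, inv_mul_cancel_left₀ hx0]
    exact mul_mem (aeval_mem_polySubalgebra ht q) hb

theorem mem_fracSubfield_of_mem [Module.Finite k B] {htr : Transcendental k t} {z : D}
    (hz : z ∈ polySubalgebra ht) : z ∈ fracSubfield ht htr :=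
  ⟨1, one_ne_zero, by simpa using hz⟩

/-- Finitely many elements of `B(t)` have a common denominator. -/
theorem exists_common_denominator [Module.Finite k B] {htr : Transcendental k t} {ι : Type*}
    (s : Finset ι) (z : ι → D) (hz : ∀ i ∈ s, z i ∈ fracSubfield ht htr) :
    ∃ q : k[X], q ≠ 0 ∧ ∀ i ∈ s, z i * aeval t q ∈ polySubalgebra ht := by
  classical
  induction s using Finset.induction_on with
  | empty => exact ⟨1, one_ne_zero, by simp⟩
  | insert a s ha ih =>
    obtain ⟨q, hq, h⟩ := ih fun i hi => hz i (Finset.mem_insert_of_mem hi)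
    obtain ⟨r, hr, h'⟩ := hz a (Finset.mem_insert_self _ _)
    refine ⟨q * r, mul_ne_zero hq hr, fun i hi => ?_⟩
    rcases Finset.mem_insert.1 hi with rfl | hi
    · rw [mul_comm q r, map_mul, ← mul_assoc]
      exact mul_mem h' (aeval_mem_polySubalgebra ht q)
    · rw [map_mul, ← mul_assoc]
      exact mul_mem (h i hi) (aeval_mem_polySubalgebra ht r)

/-- Division subrings of `B(t)` are finite-dimensional over their centers. -/
theorem isCentrallyFinite_of_le_fracSubfield [Module.Finite k B] {htr : Transcendental k t}
    {E : Subfield D} (hE : E ≤ fracSubfield ht htr) : IsCentrallyFinite E := by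
  let _ := polySubalgebraAlgebra ht
  have := finite_polySubalgebra ht
  suffices h : Module.rank (Subring.center E) E ≤ Module.finrank k[X] (polySubalgebra ht) from
    Module.rank_lt_aleph0_iff.1 (h.trans_lt Cardinal.natCast_lt_aleph0)
  -- A finite family in `E` independent over the center of `E`, multiplied by a common denominator,
  -- becomes independent over `k[X]` inside B[t].
  refine rank_le fun s hs => ?_
  obtain ⟨q, hq, hs'⟩ := exists_common_denominator ht (htr := htr) s (fun x => (x : D))
    fun x _ => hE x.2
  have hE_comm : ∀ r : k[X], ∀ x : E, Commute (x : D) (aeval t r) := by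
    intro r x
    obtain ⟨r', hr', hx⟩ := hE x.2
    have h1 := commute_aeval_of_mem_polySubalgebra ht hx r
    have h2 := (commute_aeval_of_mem_polySubalgebra ht (aeval_mem_polySubalgebra ht r') r).inv_left₀
    have h3 := h1.mul_left h2
    rwa [mul_inv_cancel_right₀ (aeval_ne_zero_of_transcendental htr hr')] at h3
  have hli : LinearIndependent k[X]
      fun x : s => (⟨(x : E) * aeval t q, hs' x x.2⟩ : polySubalgebra ht) := by
    rw [Fintype.linearIndependent_iff]
    intro g hg x
    have h1 : ∑ x : s, ((x : E) : D) * aeval t (q * g x) = 0 := by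
      have := congrArg Subtype.val hg
      rw [AddSubmonoidClass.coe_finsetSum] at this
      refine Eq.trans (Finset.sum_congr rfl fun y _ => ?_) this
      rw [coe_polySubalgebra_smul, ← (hE_comm (g y) y).mul_left
        (commute_aeval_of_mem_polySubalgebra ht (aeval_mem_polySubalgebra ht q) (g y)) |>.eq,
        map_mul, mul_assoc]
    -- The coefficients (q · g y)(t) centralize `E`, so they vanish; transcendence of `t` and `q ≠
    -- 0` then give g = 0.
    have h2 := Subfield.eq_zero_of_sum_mul_commute_eq_zero hs (fun y => hE_comm (q * g y)) h1 x
    have h3 := (transcendental_iff.1 htr) _ h2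
    exact (mul_eq_zero.1 h3).resolve_left hq
  simpa using hli.fintype_card_le_finrank

end CentralPolynomialExtension

/-! ### Linear growth and its logarithmic limit -/

section GrowthBounds

open Polynomial

variable {k D : Type*} [Field k] [DivisionRing D] [Algebra k D] {B : Subalgebra k D} {t : D}

/-- Finite-dimensional subspaces of `B(t)` have linear growth. -/
theorem exists_finrank_pow_le [Module.Finite k B] (ht : ∀ b ∈ B, Commute b t)
    (htr : Transcendental k t) (V : Submodule k D) [Module.Finite k V]
    (hV : ∀ v ∈ V, v ∈ fracSubfield ht htr) :
    ∃ C : ℕ, ∀ r, Module.finrank k (V ^ r : Submodule k D) ≤ C * (r + 1) := by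
  obtain ⟨s, rfl⟩ := (Module.Finite.iff_fg.1 ‹Module.Finite k V›)
  obtain ⟨q, hq, h⟩ := exists_common_denominator ht (htr := htr) s id
    fun x hx => hV x (Submodule.subset_span hx)
  set Q := aeval t q with hQ
  have hQ0 : Q ≠ 0 := aeval_ne_zero_of_transcendental htr hq
  obtain ⟨d, hd⟩ : ∃ d, ∀ x ∈ s, x * Q ∈ polyFiltration B t d := by
    choose! f hf using h
    exact ⟨s.sup f, fun x hx => polyFiltration_mono (Finset.le_sup hx) (hf x hx)⟩
  set V := Submodule.span k (s : Set D) with hVdef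
  have hVd : ∀ v ∈ V, v * Q ∈ polyFiltration B t d := by
    have : V ≤ (polyFiltration B t d).comap (LinearMap.mulRight k Q) :=
      Submodule.span_le.2 fun x hx => hd x hx
    exact fun v hv => this hv
  -- Each factor from `V` absorbs one `Q` at the cost of degree `d`; the denominators move past wQ
  -- because k[t] is central in B[t].
  have hpow : ∀ r, V ^ r ≤ (polyFiltration B t (d * r)).comap (LinearMap.mulRight k (Q ^ r)) := by
    intro r
    induction r with
    | zero =>
      rw [pow_zero, Submodule.one_le]
      simpa using one_mem_polyFiltration (B := B) (t := t) 0
    | succ r ih =>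
      rw [pow_succ, Submodule.mul_le]
      intro v hv w hw
      change v * w * Q ^ (r + 1) ∈ polyFiltration B t (d * (r + 1))
      have hc : Commute (w * Q) (Q ^ r) :=
        (commute_aeval_of_mem_polySubalgebra ht ⟨d, hVd w hw⟩ q).pow_right r
      have : v * w * Q ^ (r + 1) = (v * Q ^ r) * (w * Q) := by
        rw [mul_assoc v (Q ^ r), ← hc.eq, pow_succ']
        simp only [mul_assoc]
      rw [this, mul_add_one]
      exact polyFiltration_mul_le ht _ _ (Submodule.mul_mem_mul (ih hv) (hVd w hw))
  refine ⟨(d + 1) * Module.finrank k B, fun r => ?_⟩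
  have hinj : Function.Injective (LinearMap.mulRight k (Q ^ r)) :=
    mul_left_injective₀ (pow_ne_zero r hQ0)
  calc Module.finrank k (V ^ r : Submodule k D)
      = Module.finrank k ((V ^ r).map (LinearMap.mulRight k (Q ^ r))) :=
        (LinearEquiv.finrank_eq (Submodule.equivMapOfInjective _ hinj _))
    _ ≤ Module.finrank k (polyFiltration B t (d * r)) :=
        Submodule.finrank_mono (Submodule.map_le_iff_le_comap.2 (hpow r))
    _ ≤ (d * r + 1) * Module.finrank k B := finrank_polyFiltration_le _
    _ ≤ (d + 1) * Module.finrank k B * (r + 1) := by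
        rw [mul_right_comm]
        exact Nat.mul_le_mul_right _ (by nlinarith)

theorem linearIndependent_pow_of_transcendental {t : D} (htr : Transcendental k t) :
    LinearIndependent k fun i : ℕ => t ^ i := by
  have h := (basisMonomials k).linearIndependent.map' (aeval t : k[X] →ₐ[k] D).toLinearMap
    (LinearMap.ker_eq_bot.2 (transcendental_iff_injective.1 htr))
  simpa [Function.comp_def] using h

theorem le_finrank_span_pow {t : D} (htr : Transcendental k t) (r : ℕ) :
    r + 1 ≤ Module.finrank k ((Submodule.span k {1, t}) ^ r : Submodule k D) := by
  have hli : LinearIndependent k fun i : Fin (r + 1) => t ^ (i : ℕ) :=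
    (linearIndependent_pow_of_transcendental htr).comp _ Fin.val_injective
  set V := Submodule.span k ({1, t} : Set D) with hV
  have h1 : (1 : D) ∈ V := Submodule.subset_span (by simp)
  have ht : t ∈ V := Submodule.subset_span (by simp)
  have hmem : ∀ i : Fin (r + 1), t ^ (i : ℕ) ∈ V ^ r := fun i => by
    have h := Submodule.mul_mem_mul (Submodule.pow_mem_pow V ht (i : ℕ))
      (Submodule.pow_mem_pow V h1 (r - i))
    rwa [one_pow, mul_one, ← pow_add, Nat.add_sub_cancel' (Nat.lt_succ_iff.1 i.2)] at h
  have hfin : Module.Finite k (V ^ r : Submodule k D) :=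
    Module.Finite.iff_fg.2 ((Submodule.fg_span (by simp)).pow r)
  have hli' : LinearIndependent k fun i : Fin (r + 1) => (⟨_, hmem i⟩ : (V ^ r : Submodule k D)) :=
    LinearIndependent.of_comp (V ^ r).subtype hli
  simpa using hli'.fintype_card_le_finrank

open Filter Topology in
-- For r ≥ 2 the expression equals log C / log r + log(1 + 1/r) / log r + 1, and the first two terms
-- tend to 0.
theorem tendsto_logb_mul_succ {C : ℝ} (hC : 0 < C) :
    Tendsto (fun r : ℕ => Real.logb r (C * (r + 1))) atTop (𝓝 1) := by
  have hlog : Tendsto (fun r : ℕ => Real.log r) atTop atTop :=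
    Real.tendsto_log_atTop.comp tendsto_natCast_atTop_atTop
  have h1 : Tendsto (fun r : ℕ => Real.log C / Real.log r) atTop (𝓝 0) :=
    tendsto_const_nhds.div_atTop hlog
  have h2 : Tendsto (fun r : ℕ => Real.log (1 + (r : ℝ)⁻¹) / Real.log r) atTop (𝓝 0) := by
    refine Tendsto.div_atTop (a := Real.log (1 + 0)) ?_ hlog
    refine Tendsto.log (tendsto_const_nhds.add tendsto_inv_atTop_nhds_zero_nat) (by norm_num)
  have h3 := (h1.add h2).add (tendsto_const_nhds (x := (1 : ℝ)))
  rw [zero_add, zero_add] at h3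
  refine h3.congr' ?_
  filter_upwards [eventually_ge_atTop 2] with r hr
  have hr1 : (1 : ℝ) < r := by exact_mod_cast hr
  have hlr : Real.log r ≠ 0 := (Real.log_pos hr1).ne'
  have hr0 : (r : ℝ) ≠ 0 := by positivity
  have : C * (r + 1 : ℝ) = C * ((1 + (r : ℝ)⁻¹) * r) := by field_simp
  rw [Real.logb, this, Real.log_mul hC.ne' (by positivity), Real.log_mul (by positivity) hr0]
  field_simp
  ring

open Filter in
theorem limsup_logb_le_one {f : ℕ → ℕ} {C : ℕ} (hf : ∀ r, f r ≤ C * (r + 1)) :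
    limsup (fun r : ℕ => ((Real.logb r (f r) : ℝ) : EReal)) atTop ≤ 1 := by
  -- `C` may be 0, so the comparison uses C + 1. The case `f r = 0` below relies on the convention
  -- `Real.logb r 0 = 0`.
  have hC : (0 : ℝ) < (C : ℝ) + 1 := by positivity
  have hlim : Tendsto (fun r : ℕ => ((Real.logb r (((C : ℝ) + 1) * (r + 1)) : ℝ) : EReal)) atTop
      (nhds ((1 : ℝ) : EReal)) := (continuous_coe_real_ereal.tendsto 1).comp
        (tendsto_logb_mul_succ hC)
  rw [← EReal.coe_one, ← hlim.limsup_eq]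
  refine limsup_le_limsup ?_
  filter_upwards [eventually_ge_atTop 2] with r hr
  have hr1 : (1 : ℝ) < r := by exact_mod_cast hr
  refine EReal.coe_le_coe_iff.2 ?_
  have hbig : (1 : ℝ) ≤ ((C : ℝ) + 1) * (r + 1) := by
    have : (0 : ℝ) ≤ C := C.cast_nonneg
    nlinarith
  rcases Nat.eq_zero_or_pos (f r) with h | h
  · rw [h, Nat.cast_zero, Real.logb_zero]
    exact Real.logb_nonneg hr1 hbig
  · refine Real.logb_le_logb_of_le hr1 (by exact_mod_cast h) ?_
    have h1 : ((f r : ℕ) : ℝ) ≤ C * (r + 1) := by exact_mod_cast hf r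
    nlinarith

open Filter in
theorem one_le_limsup_logb {f : ℕ → ℕ} (hf : ∀ r, r + 1 ≤ f r) :
    1 ≤ limsup (fun r : ℕ => ((Real.logb r (f r) : ℝ) : EReal)) atTop := by
  refine le_limsup_of_frequently_le (Eventually.frequently ?_)
  filter_upwards [eventually_ge_atTop 2] with r hr
  have hr1 : (1 : ℝ) < r := by exact_mod_cast hr
  rw [← EReal.coe_one]
  refine EReal.coe_le_coe_iff.2 ?_
  rw [Real.le_logb_iff_rpow_le hr1 (by exact_mod_cast (Nat.succ_pos r).trans_le (hf r)),
    Real.rpow_one]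
  exact_mod_cast (Nat.le_succ r).trans (hf r)

end GrowthBounds

/-! ### Finite-dimensionality and transcendence criteria -/

section FiniteAdjoin

variable {k A : Type*} [Field k] [Ring A] [Algebra k A]

/-- A finite set of elements that commute up to scalars and have scalar squares generates a
finite-dimensional algebra. -/
theorem finite_adjoin_of_quasiCommute (s : Set A) (hs : s.Finite)
    (hsq : ∀ u ∈ s, ∃ c : k, u * u = algebraMap k A c)
    (hcomm : ∀ u ∈ s, ∀ v ∈ s, ∃ c : k, u * v = c • (v * u)) :
    Module.Finite k (Algebra.adjoin k s) := by
  induction s, hs using Set.Finite.induction_on with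
  | empty =>
    rw [Algebra.adjoin_empty]
    infer_instance
  | @insert u s hu hs ih =>
    have ih := ih (fun v hv => hsq v (Or.inr hv))
      fun v hv w hw => hcomm v (Or.inr hv) w (Or.inr hw)
    set S := Algebra.adjoin k s with hS
    -- `u` can be moved to the right past `S`, and u² is a scalar; hence S + Su is closed under
    -- multiplication and contains the enlarged algebra.
    have hSu : ∀ a ∈ S, ∃ a' ∈ S, u * a = a' * u := by
      intro a ha
      induction ha using Algebra.adjoin_induction with
      | mem v hv =>
        obtain ⟨c, hc⟩ := hcomm u (Or.inl rfl) v (Or.inr hv)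
        exact ⟨c • v, S.smul_mem (Algebra.subset_adjoin hv) c, by rw [hc, smul_mul_assoc]⟩
      | algebraMap r => exact ⟨_, S.algebraMap_mem r, (Algebra.commutes r u).symm⟩
      | add x y _ _ hx hy =>
        obtain ⟨x', hx', hx⟩ := hx
        obtain ⟨y', hy', hy⟩ := hy
        exact ⟨x' + y', add_mem hx' hy', by rw [mul_add, add_mul, hx, hy]⟩
      | mul x y _ _ hx hy =>
        obtain ⟨x', hx', hx⟩ := hx
        obtain ⟨y', hy', hy⟩ := hy
        exact ⟨x' * y', mul_mem hx' hy', by rw [← mul_assoc, hx, mul_assoc, hy, mul_assoc]⟩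
    obtain ⟨c, hc⟩ := hsq u (Or.inl rfl)
    let T : Subalgebra k A :=
      { carrier := {z | ∃ a ∈ S, ∃ b ∈ S, z = a + b * u}
        mul_mem' := by
          rintro _ _ ⟨a, ha, b, hb, rfl⟩ ⟨a', ha', b', hb', rfl⟩
          obtain ⟨a₁, ha₁, h1⟩ := hSu a' ha'
          obtain ⟨b₁, hb₁, h2⟩ := hSu b' hb'
          refine ⟨a * a' + b * b₁ * algebraMap k A c, add_mem (mul_mem ha ha')
            (mul_mem (mul_mem hb hb₁) (S.algebraMap_mem c)), a * b' + b * a₁,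
            add_mem (mul_mem ha hb') (mul_mem hb ha₁), ?_⟩
          have h3 : b * u * a' = b * a₁ * u := by rw [mul_assoc, h1, mul_assoc]
          have h4 : b * u * (b' * u) = b * b₁ * algebraMap k A c := by
            rw [← hc, mul_assoc, ← mul_assoc u, h2]
            simp only [mul_assoc]
          rw [add_mul, mul_add, mul_add, h3, h4, add_mul, mul_assoc a b' u]
          abel
        add_mem' := by
          rintro _ _ ⟨a, ha, b, hb, rfl⟩ ⟨a', ha', b', hb', rfl⟩
          exact ⟨a + a', add_mem ha ha', b + b', add_mem hb hb', by rw [add_mul]; abel⟩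
        algebraMap_mem' := fun r => ⟨_, S.algebraMap_mem r, 0, zero_mem _, by simp⟩ }
    have hle : Algebra.adjoin k (insert u s) ≤ T := by
      refine Algebra.adjoin_le ?_
      rintro v (rfl | hv)
      · exact ⟨0, zero_mem _, 1, one_mem _, by simp⟩
      · exact ⟨v, Algebra.subset_adjoin hv, 0, zero_mem _, by simp⟩
    have hfin : Module.Finite k (LinearMap.range (S.val.toLinearMap.coprod
        (LinearMap.mulRight k u ∘ₗ S.val.toLinearMap))) := inferInstance
    refine Submodule.finiteDimensional_of_le
      (S₁ := Subalgebra.toSubmodule (Algebra.adjoin k (insert u s)))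
      (S₂ := LinearMap.range (S.val.toLinearMap.coprod
        (LinearMap.mulRight k u ∘ₗ S.val.toLinearMap))) fun z hz => ?_
    obtain ⟨a, ha, b, hb, rfl⟩ := hle hz
    exact ⟨(⟨a, ha⟩, ⟨b, hb⟩), by simp⟩

open scoped IsMulCommutative in
/-- An element having infinitely many conjugates that commute with each other is transcendental
over the base field. -/
theorem transcendental_of_infinite_conjugates {D : Type*} [DivisionRing D] [Algebra k D] {t : D}
    {T : Set D} (hT : T.Infinite) (hcomm : ∀ x ∈ T, ∀ y ∈ T, x * y = y * x)
    (hconj : ∀ x ∈ T, ∃ s : D, s ≠ 0 ∧ s * t = x * s) : Transcendental k t := by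
  rintro ⟨p, hp, hpt⟩
  -- The conjugates generate a commutative domain, where a nonzero polynomial has only finitely many
  -- roots. Conjugation fixes `k`, so each of them is a root of `p`.
  have := Algebra.isMulCommutative_adjoin k hcomm
  have hroot : ∀ x (hx : x ∈ T), Polynomial.aeval x p = 0 := by
    intro x hx
    obtain ⟨s, hs0, hs⟩ := hconj x hx
    have h : ∀ q : Polynomial k, s * Polynomial.aeval t q = Polynomial.aeval x q * s := by
      intro q
      induction q using Polynomial.induction_on' with
      | add p q hp hq => rw [map_add, map_add, mul_add, add_mul, hp, hq]
      | monomial n a =>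
        have hpow : s * t ^ n = x ^ n * s := (SemiconjBy.pow_right (show SemiconjBy s t x from hs) n)
        rw [Polynomial.aeval_monomial, Polynomial.aeval_monomial, ← mul_assoc,
          ← Algebra.commutes a s, mul_assoc, hpow, mul_assoc]
    have := h p
    rw [hpt, mul_zero] at this
    exact (mul_eq_zero.1 this.symm).resolve_right hs0
  have hinf : {x : Algebra.adjoin k T | Polynomial.aeval x p = 0}.Infinite := by
    refine Set.Infinite.mono (s := (fun x : Algebra.adjoin k T => (x : D)) ⁻¹' T) ?_ ?_
    · intro x hx
      apply Subtype.ext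
      exact (Polynomial.aeval_algHom_apply (Algebra.adjoin k T).val x p).symm.trans (hroot x hx)
    · refine Set.Infinite.preimage hT fun x hx => ?_
      exact ⟨⟨x, Algebra.subset_adjoin hx⟩, rfl⟩
  refine hp (Polynomial.map_injective (algebraMap k (Algebra.adjoin k T))
    (algebraMap k (Algebra.adjoin k T)).injective ?_)
  rw [Polynomial.map_zero]
  refine Polynomial.eq_zero_of_infinite_isRoot _ (hinf.mono fun x hx => ?_)
  rw [Set.mem_ofPred_eq, Polynomial.IsRoot.def, Polynomial.eval_map]
  exact hx

end FiniteAdjoin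

/-! ### Towers of anticommuting pairs -/

/-- A nonzero such `x` has x⁻¹ = c⁻¹x. This puts (u n)⁻¹, the difference of consecutive tails, into
the next stage, which is only a subalgebra. -/
theorem Subalgebra.inv_mem_of_mul_self_mem_center {k R : Type*} [Field k]
    [DivisionRing R] [Algebra k R] {x : R} {c : k}
    (hx : x * x = algebraMap k R c) {S : Subalgebra k R} (hS : x ∈ S) : x⁻¹ ∈ S := by
  by_cases h0 : x = 0
  · rwa [h0, inv_zero, ← h0]
  have hc : c ≠ 0 := by
    rintro rfl
    rw [map_zero] at hx
    exact h0 (mul_self_eq_zero.1 hx)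
  have : x⁻¹ = c⁻¹ • x := by
    refine inv_eq_of_mul_eq_one_right ?_
    rw [mul_smul_comm, hx, Algebra.algebraMap_eq_smul_one, smul_smul, inv_mul_cancel₀ hc, one_smul]
  exact this ▸ S.smul_mem hS _

/-- Generators of a tower of tensor products of quaternion algebras: the `u i` and `s i` have
central squares and commute with each other, except that `u i` and `s i` anticommute; the `t n`
are the tails of the formal sum `∑ (u i)⁻¹`, and `t n` commutes with the `n`-th stage. -/
structure IsQuaternionTower {R : Type*} [DivisionRing R] (u s t : ℕ → R) : Prop where
  two_ne_zero : (2 : R) ≠ 0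
  u_injective : Function.Injective u
  u_ne_zero : ∀ i, u i ≠ 0
  u_sq : ∀ i, u i * u i ∈ Subring.center R
  s_ne_zero : ∀ i, s i ≠ 0
  s_sq : ∀ i, s i * s i ∈ Subring.center R
  u_comm : ∀ i j, Commute (u i) (u j)
  s_comm : ∀ i j, Commute (s i) (s j)
  u_s : ∀ i j, i ≠ j → Commute (u i) (s j)
  u_s_self : ∀ i, u i * s i = -(s i * u i)
  t_u : ∀ n i, Commute (t n) (u i)
  t_s : ∀ n i, i < n → Commute (t n) (s i)
  t_succ : ∀ n, t n = t (n + 1) + (u n)⁻¹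
  closure_eq_top : Subfield.closure (Set.range u ∪ Set.range s ∪ {t 0}) = ⊤

namespace IsQuaternionTower

variable {R : Type*} [DivisionRing R] {u s t : ℕ → R}

/-- The finite-dimensional algebra generated by the first `n` pairs. -/
def stage (u s : ℕ → R) (n : ℕ) : Subalgebra (Subring.center R) R :=
  Algebra.adjoin _ (u '' Set.Iio n ∪ s '' Set.Iio n)

theorem stage_mono : Monotone (stage u s) := fun _ _ h =>
  Algebra.adjoin_mono (Set.union_subset_union
    (Set.image_mono (Set.Iio_subset_Iio h)) (Set.image_mono (Set.Iio_subset_Iio h)))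

theorem u_mem_stage {i n : ℕ} (h : i < n) : u i ∈ stage u s n :=
  Algebra.subset_adjoin (Or.inl ⟨i, h, rfl⟩)

theorem s_mem_stage {i n : ℕ} (h : i < n) : s i ∈ stage u s n :=
  Algebra.subset_adjoin (Or.inr ⟨i, h, rfl⟩)

variable (h : IsQuaternionTower u s t)
include h

theorem quasiCommute_u_s (i j : ℕ) :
    (∃ c : Subring.center R, u i * s j = c • (s j * u i)) ∧
      ∃ c : Subring.center R, s j * u i = c • (u i * s j) := by
  by_cases hij : i = j
  · subst hij
    exact ⟨⟨-1, by rw [h.u_s_self, neg_smul, one_smul]⟩,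
      ⟨-1, by rw [h.u_s_self, neg_smul, one_smul, neg_neg]⟩⟩
  · exact ⟨⟨1, by rw [one_smul, (h.u_s i j hij).eq]⟩, ⟨1, by rw [one_smul, (h.u_s i j hij).eq]⟩⟩

theorem finite_stage (n : ℕ) : Module.Finite (Subring.center R) (stage u s n) := by
  refine finite_adjoin_of_quasiCommute _
    (((Set.finite_Iio n).image u).union ((Set.finite_Iio n).image s)) ?_ ?_
  · rintro _ (⟨i, -, rfl⟩ | ⟨i, -, rfl⟩)
    · exact ⟨⟨_, h.u_sq i⟩, rfl⟩
    · exact ⟨⟨_, h.s_sq i⟩, rfl⟩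
  · rintro _ (⟨i, -, rfl⟩ | ⟨i, -, rfl⟩) _ (⟨j, -, rfl⟩ | ⟨j, -, rfl⟩)
    · exact ⟨1, by rw [one_smul, (h.u_comm i j).eq]⟩
    · exact (h.quasiCommute_u_s i j).1
    · exact (h.quasiCommute_u_s j i).2
    · exact ⟨1, by rw [one_smul, (h.s_comm i j).eq]⟩

theorem commute_stage (n : ℕ) : ∀ b ∈ stage u s n, Commute b (t n) := by
  have : stage u s n ≤ Subalgebra.centralizer _ {t n} := by
    refine Algebra.adjoin_le ?_
    rintro _ (⟨i, -, rfl⟩ | ⟨i, hi, rfl⟩)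
    · exact (Subalgebra.mem_centralizer_iff _).2 fun _ ht => ht ▸ (h.t_u n i).eq
    · exact (Subalgebra.mem_centralizer_iff _).2 fun _ ht => ht ▸ (h.t_s n i hi).eq
  exact fun b hb => ((Subalgebra.mem_centralizer_iff _).1 (this hb) (t n) rfl).symm

/-- Conjugation by `s i` flips the sign of the single term (u i)⁻¹ of the tail and fixes everything
else. The induction descends from n = i, where t (i + 1) commutes with `s i`. -/
theorem s_mul_t {n i : ℕ} (hn : n ≤ i) : s i * t n = (t n - 2 * (u i)⁻¹) * s i := by
  induction hn using Nat.decreasingInduction with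
  | self =>
    have h1 : s i * (u i)⁻¹ = -((u i)⁻¹ * s i) := by
      have := h.u_s_self i
      rw [eq_neg_iff_add_eq_zero, ← mul_right_inj' (h.u_ne_zero i), mul_add, ← mul_assoc, this,
        mul_zero, neg_mul, mul_inv_cancel_right₀ (h.u_ne_zero i),
        mul_inv_cancel_left₀ (h.u_ne_zero i), neg_add_cancel]
    rw [h.t_succ i, mul_add, h1, ← (h.t_s (i + 1) i i.lt_succ_self).eq, two_mul]
    noncomm_ring
  | of_succ j hj ih =>
    have h1 : s i * (u j)⁻¹ = (u j)⁻¹ * s i := (h.u_s j i (Nat.ne_of_lt hj)).symm.inv_right₀.eq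
    rw [h.t_succ j, mul_add, ih, h1]
    noncomm_ring

/-- The conjugates t n − 2(u i)⁻¹ for i ≥ n commute, and they are distinct because `u` is injective
and 2 ≠ 0. -/
theorem transcendental_t (n : ℕ) : Transcendental (Subring.center R) (t n) := by
  refine transcendental_of_infinite_conjugates
    (T := (fun i => t n - 2 * (u i)⁻¹) '' Set.Ici n) ?_ ?_ ?_
  · refine (Set.Ici_infinite n).image (Function.Injective.injOn fun i j hij => ?_)
    exact h.u_injective (inv_injective (mul_left_cancel₀ h.two_ne_zero (sub_right_injective hij)))
  · rintro _ ⟨i, -, rfl⟩ _ ⟨j, -, rfl⟩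
    have hi : ∀ i, Commute (t n) (2 * (u i)⁻¹) := fun i =>
      (Commute.ofNat_right _ 2).mul_right (h.t_u n i).inv_right₀
    have hij : Commute (2 * (u i)⁻¹) (2 * (u j)⁻¹) :=
      (Commute.ofNat_left 2 _).mul_left
        ((Commute.ofNat_right _ 2).mul_right (h.u_comm i j).inv_left₀.inv_right₀)
    exact ((Commute.refl _).sub_right (hi j)).sub_left ((hi i).symm.sub_right hij)
  · rintro _ ⟨i, hi, rfl⟩
    exact ⟨s i, h.s_ne_zero i, h.s_mul_t hi⟩

theorem polySubalgebra_le_succ (n : ℕ) :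
    polySubalgebra (h.commute_stage n) ≤ polySubalgebra (h.commute_stage (n + 1)) := by
  refine polySubalgebra_le _ ((stage_mono n.le_succ).trans (le_polySubalgebra _)) ?_
  rw [h.t_succ n]
  exact add_mem (self_mem_polySubalgebra _) (le_polySubalgebra _
    (Subalgebra.inv_mem_of_mul_self_mem_center (c := ⟨_, h.u_sq n⟩) rfl (u_mem_stage n.lt_succ_self)))

/-- The division subring generated by the `n`-th stage and the central element `t n`. -/
def subfield (n : ℕ) : Subfield R :=
  haveI := h.finite_stage n
  fracSubfield (h.commute_stage n) (h.transcendental_t n)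

theorem subfield_mono : Monotone h.subfield := by
  refine monotone_nat_of_le_succ fun n z hz => ?_
  have := h.finite_stage n
  have := h.finite_stage (n + 1)
  obtain ⟨q, hq, hzq⟩ := hz
  have hle : ∀ x ∈ polySubalgebra (h.commute_stage n), x ∈ h.subfield (n + 1) := fun x hx =>
    mem_fracSubfield_of_mem _ (h.polySubalgebra_le_succ n hx)
  -- The denominator q(t n) need not be a polynomial in t (n + 1) over the center, but its inverse
  -- lies in the next division ring.
  have h1 := mul_mem (hle _ hzq) (inv_mem (hle _ (aeval_mem_polySubalgebra _ q)))
  rwa [mul_inv_cancel_right₀ (aeval_ne_zero_of_transcendental (h.transcendental_t n) hq)] at h1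

theorem exists_mem_subfield (x : R) : ∃ n, x ∈ h.subfield n := by
  rw [← Subfield.mem_iSup_of_directed h.subfield_mono.directed_le]
  suffices h' : (⊤ : Subfield R) ≤ ⨆ n, h.subfield n from h' (Subfield.mem_top x)
  rw [← h.closure_eq_top, Subfield.closure_le]
  have hmem : ∀ n, ∀ y ∈ polySubalgebra (h.commute_stage n), y ∈ ⨆ n, h.subfield n := fun n y hy =>
    have := h.finite_stage n
    le_iSup h.subfield n (mem_fracSubfield_of_mem _ hy)
  rintro _ ((⟨i, rfl⟩ | ⟨i, rfl⟩) | rfl)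
  · exact hmem (i + 1) _ (le_polySubalgebra _ (u_mem_stage i.lt_succ_self))
  · exact hmem (i + 1) _ (le_polySubalgebra _ (s_mem_stage i.lt_succ_self))
  · exact hmem 0 _ (self_mem_polySubalgebra _)

theorem exists_subset_subfield {S : Set R} (hS : S.Finite) : ∃ n, ∀ x ∈ S, x ∈ h.subfield n := by
  choose f hf using h.exists_mem_subfield
  obtain ⟨n, hn⟩ := (hS.image f).bddAbove
  exact ⟨n, fun x hx => h.subfield_mono (hn ⟨x, hx, rfl⟩) (hf x)⟩

theorem isWeaklyLocallyFinite : IsWeaklyLocallyFinite R := by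
  intro S hS
  obtain ⟨n, hn⟩ := h.exists_subset_subfield hS
  have := h.finite_stage n
  exact isCentrallyFinite_of_le_fracSubfield _ (htr := h.transcendental_t n)
    (Subfield.closure_le.2 hn)

theorem not_isAlgebraic : ¬ Algebra.IsAlgebraic (Subring.center R) R := fun halg =>
  h.transcendental_t 0 (halg.isAlgebraic _)

theorem divisionRingGKDim_eq_one : divisionRingGKDim R = 1 := by
  rw [divisionRingGKDim, gkDim]
  refine le_antisymm (iSup_le fun V => iSup_le fun hV => iSup_le fun _ => ?_) ?_
  · obtain ⟨S, hS⟩ := Module.Finite.iff_fg.1 hV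
    obtain ⟨n, hn⟩ := h.exists_subset_subfield S.finite_toSet
    have := h.finite_stage n
    obtain ⟨C, hC⟩ := exists_finrank_pow_le (h.commute_stage n) (h.transcendental_t n) V
      fun v hv => by
        -- For one fixed denominator, membership is a linear condition, so it passes from the
        -- generators to all of `V`.
        obtain ⟨q, hq, hq'⟩ := exists_common_denominator (h.commute_stage n)
          (htr := h.transcendental_t n) S id hn
        refine ⟨q, hq, ?_⟩
        have : V ≤ (Subalgebra.toSubmodule (polySubalgebra (h.commute_stage n))).comap
            (LinearMap.mulRight _ (Polynomial.aeval (t n) q)) := by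
          rw [← hS]
          exact Submodule.span_le.2 hq'
        exact this hv
    exact limsup_logb_le_one hC
  · refine le_iSup_of_le (Submodule.span _ {1, t 0})
      (le_iSup_of_le (Module.Finite.span_of_finite _ (by simp))
        (le_iSup_of_le (Submodule.subset_span (by simp)) ?_))
    exact one_le_limsup_logb (le_finrank_span_pow (h.transcendental_t 0))

end IsQuaternionTower

/-! ### Galois theory of the multiquadratic field -/

section MultiquadraticField

open IntermediateField Polynomial

theorem isIntegral_sqrt_natCast (n : ℕ) : IsIntegral ℚ (√(n : ℝ)) :=
  ⟨X ^ 2 - C (n : ℚ), monic_X_pow_sub_C _ two_ne_zero, by simp⟩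

/-- A rational number that becomes a square in `ℚ(√n : n ∈ S)` is a square up to a product of
elements of `S`. -/
theorem exists_isSquare_mul_prod_of_mem_adjoin_sqrt (S : Finset ℕ) :
    ∀ (a : ℚ) (z : ℝ), z ∈ adjoin ℚ ((fun n : ℕ => √(n : ℝ)) '' S) → z ^ 2 = a →
      ∃ T ⊆ S, IsSquare (a * ∏ n ∈ T, (n : ℚ)) := by
  classical
  induction S using Finset.induction_on with
  | empty =>
    intro a z hz ha
    rw [Finset.coe_empty, Set.image_empty, adjoin_empty, mem_bot] at hz
    obtain ⟨q, rfl⟩ := hz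
    refine ⟨∅, subset_rfl, q, ?_⟩
    rw [Finset.prod_empty, mul_one, ← sq]
    have h : ((q : ℝ)) ^ 2 = a := ha
    exact_mod_cast h.symm
  | insert n S hn ih =>
    intro a z hz ha
    set F := adjoin ℚ ((fun n : ℕ => √(n : ℝ)) '' S) with hF
    have hnn : √(n : ℝ) * √(n : ℝ) = n := Real.mul_self_sqrt n.cast_nonneg
    have hnF : (n : ℝ) ∈ F := _root_.natCast_mem F n
    have hform : ∀ w ∈ Algebra.adjoin ℚ ((fun n : ℕ => √(n : ℝ)) '' (insert n S : Finset ℕ)),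
        ∃ x ∈ F, ∃ y ∈ F, w = x + y * √(n : ℝ) := by
      intro w hw
      induction hw using Algebra.adjoin_induction with
      | mem w hw =>
        obtain ⟨m, hm, rfl⟩ := hw
        rcases Finset.mem_insert.1 hm with rfl | hm
        · exact ⟨0, zero_mem _, 1, one_mem _, by simp⟩
        · exact ⟨_, subset_adjoin _ _ ⟨m, hm, rfl⟩, 0, zero_mem _, by simp⟩
      | algebraMap r => exact ⟨_, F.algebraMap_mem r, 0, zero_mem _, by simp⟩
      | add u v _ _ hu hv =>
        obtain ⟨x, hx, y, hy, rfl⟩ := hu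
        obtain ⟨x', hx', y', hy', rfl⟩ := hv
        exact ⟨x + x', add_mem hx hx', y + y', add_mem hy hy', by ring⟩
      | mul u v _ _ hu hv =>
        obtain ⟨x, hx, y, hy, rfl⟩ := hu
        obtain ⟨x', hx', y', hy', rfl⟩ := hv
        exact ⟨x * x' + y * y' * n, add_mem (mul_mem hx hx') (mul_mem (mul_mem hy hy') hnF),
          x * y' + y * x', add_mem (mul_mem hx hy') (mul_mem hy hx'),
          by linear_combination y * y' * hnn⟩
    obtain ⟨x, hx, y, hy, rfl⟩ : ∃ x ∈ F, ∃ y ∈ F, z = x + y * √(n : ℝ) := by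
      refine hform z ?_
      rw [← adjoin_toSubalgebra_of_isAlgebraic]
      · exact hz
      · rintro _ ⟨m, -, rfl⟩
        exact (isIntegral_sqrt_natCast m).isAlgebraic
    have hexp : x ^ 2 + y ^ 2 * n + 2 * x * y * √(n : ℝ) = a := by
      rw [← ha]
      linear_combination -y ^ 2 * hnn
    -- If y = 0, then z is in `F`. If x = 0, then an = (yn)² with yn in `F`, which adds `n` to the
    -- product. Otherwise the expansion of z² expresses √n in `F`, so z is again in `F`.
    by_cases hy0 : y = 0
    · obtain ⟨T, hT, h⟩ := ih a x hx (by rw [← hexp, hy0]; ring)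
      exact ⟨T, hT.trans (Finset.subset_insert _ _), h⟩
    by_cases hx0 : x = 0
    · obtain ⟨T, hT, h⟩ := ih (a * n) (y * n) (mul_mem hy hnF)
        (by push_cast; rw [← hexp, hx0]; ring)
      refine ⟨insert n T, Finset.insert_subset_insert _ hT, ?_⟩
      rwa [Finset.prod_insert fun h => hn (hT h), ← mul_assoc]
    have hsq : √(n : ℝ) ∈ F := by
      have : √(n : ℝ) = (a - x ^ 2 - y ^ 2 * n) / (2 * x * y) := by
        rw [eq_div_iff (by positivity), ← hexp]; ring
      rw [this]
      exact div_mem (sub_mem (sub_mem (F.algebraMap_mem a) (pow_mem hx 2))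
        (mul_mem (pow_mem hy 2) hnF)) (mul_mem (mul_mem (ofNat_mem F 2) hx) hy)
    obtain ⟨T, hT, h⟩ := ih a _ (add_mem hx (mul_mem hy hsq)) ha
    exact ⟨T, hT.trans (Finset.subset_insert _ _), h⟩

theorem sqrt_prime_notMem_adjoin {q : ℕ} (hq : q.Prime) {P : Set ℕ} (hP : ∀ n ∈ P, n.Prime)
    (hqP : q ∉ P) : √(q : ℝ) ∉ adjoin ℚ ((fun n : ℕ => √(n : ℝ)) '' P) := by
  classical
  intro h
  obtain ⟨s, hs, hmem⟩ := exists_finset_of_mem_adjoin h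
  obtain ⟨S, hSP, rfl⟩ := Finset.subset_set_image_iff.1 hs
  rw [Finset.coe_image] at hmem
  obtain ⟨T, hT, hsq⟩ := exists_isSquare_mul_prod_of_mem_adjoin_sqrt S q _ hmem (by simp)
  rw [← Nat.cast_prod, ← Nat.cast_mul, Rat.isSquare_natCast_iff] at hsq
  obtain ⟨r, hr⟩ := hsq
  -- In the square q∏T the prime q would occur to an even power, so it must divide a member of `T`,
  -- all of which are primes other than q.
  have hqr : q ∣ r := (or_self_iff.1 (hq.dvd_mul.1 (hr ▸ dvd_mul_right _ _)))
  obtain ⟨c, rfl⟩ := hqr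
  have : ∏ n ∈ T, n = q * (c * c) := Nat.eq_of_mul_eq_mul_left hq.pos (by rw [hr]; ring)
  obtain ⟨n, hn, hqn⟩ := (hq.prime.dvd_finsetProd_iff _).1 (Dvd.intro _ this.symm)
  exact hqP (((Nat.prime_dvd_prime_iff_eq hq (hP n (hSP (hT hn)))).1 hqn) ▸ hSP (hT hn))

variable (p : ℕ → ℕ)

@[simp]
theorem coe_sqrtElem (i : ℕ) : (sqrtElem p i : ℝ) = √(p i : ℝ) := rfl

theorem sqrtElem_sq (i : ℕ) : sqrtElem p i ^ 2 = (p i : SqrtField p) :=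
  Subtype.ext (by simp)

/-- The minimal polynomial of a generator y divides X² − a = (X − y)(X + y), which already splits in
the adjoined field; characteristic zero gives separability. -/
theorem isGalois_adjoin_of_sq {F E : Type*} [Field F] [CharZero F] [Field E] [Algebra F E]
    {s : Set E} (hs : ∀ x ∈ s, ∃ a : F, x ^ 2 = algebraMap F E a) : IsGalois F (adjoin F s) := by
  have hint : ∀ x ∈ s, IsIntegral F x := fun x hx =>
    let ⟨a, ha⟩ := hs x hx
    ⟨X ^ 2 - C a, monic_X_pow_sub_C _ two_ne_zero, by simp [ha]⟩
  have halg : Algebra.IsAlgebraic F (adjoin F s) := isAlgebraic_adjoin fun x hx => hint x hx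
  have hnormal : Normal F (adjoin F s) := by
    refine { splits' := fun x => ?_ }
    rw [← minpoly.algebraMap_eq (algebraMap (adjoin F s) E).injective x]
    refine splits_of_mem_adjoin F E (S := s) (fun y hy => ⟨hint y hy, ?_⟩) x.2
    obtain ⟨a, ha⟩ := hs y hy
    have hdvd : minpoly F y ∣ X ^ 2 - C a := minpoly.dvd _ _ (by simp [ha])
    set y' : adjoin F s := ⟨y, subset_adjoin F s hy⟩ with hy'
    have hsq : algebraMap F (adjoin F s) a = y' ^ 2 := Subtype.ext ha.symm
    have hfac : (X ^ 2 - C a).map (algebraMap F (adjoin F s)) = (X - C y') * (X + C y') := by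
      simp only [Polynomial.map_sub, Polynomial.map_pow, map_X, map_C]
      rw [hsq, C_pow]
      ring
    refine Splits.of_dvd (g := (X ^ 2 - C a).map (algebraMap F (adjoin F s))) ?_ ?_
      (Polynomial.map_dvd _ hdvd)
    · rw [hfac]
      exact (Splits.X_sub_C _).mul (Splits.X_add_C _)
    · exact Polynomial.map_ne_zero (X_pow_sub_C_ne_zero two_pos _)
  exact ⟨⟩

/-- By the infinite Galois correspondence, an element fixed by every automorphism fixing `L` lies in
`L`. -/
theorem exists_algEquiv_ne_of_notMem_adjoin {F E : Type*} [Field F] [Field E] [Algebra F E]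
    {s t : Set E} [IsGalois F (adjoin F s)] (x : adjoin F s)
    (hx : (x : E) ∉ adjoin F t) : ∃ σ : adjoin F s ≃ₐ[F] adjoin F s, σ x ≠ x ∧
      ∀ y : adjoin F s, (y : E) ∈ t → σ y = y := by
  set L : IntermediateField F (adjoin F s) := adjoin F {y | (y : E) ∈ t} with hL
  have hxL : x ∉ L := by
    intro h
    have h1 : (x : E) ∈ L.map (adjoin F s).val := ⟨_, h, rfl⟩
    rw [hL, adjoin_map] at h1
    refine hx (adjoin.mono F _ _ ?_ h1)
    rintro _ ⟨y, hy, rfl⟩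
    exact hy
  rw [← InfiniteGalois.fixedField_fixingSubgroup L, mem_fixedField_iff] at hxL
  push Not at hxL
  obtain ⟨σ, hσ, hne⟩ := hxL
  exact ⟨σ, hne, fun y hy =>
    (IntermediateField.mem_fixingSubgroup_iff _ _).1 hσ _ (subset_adjoin _ _ hy)⟩

variable {p}

theorem exists_ringAut_sqrtElem_single (hp : ∀ i, (p i).Prime) (hinj : Function.Injective p)
    (i : ℕ) : ∃ σ : RingAut (SqrtField p), σ (sqrtElem p i) = -sqrtElem p i ∧
      ∀ j ≠ i, σ (sqrtElem p j) = sqrtElem p j := by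
  have hgal := isGalois_adjoin_of_sq (F := ℚ) (E := ℝ) (s := Set.range fun i => √(p i : ℝ)) (by
    rintro _ ⟨i, rfl⟩
    exact ⟨p i, by simp⟩)
  have hi : (sqrtElem p i : ℝ) ∉ adjoin ℚ ((fun i => √(p i : ℝ)) '' {i}ᶜ) := by
    intro h
    refine sqrt_prime_notMem_adjoin (hp i) (P := p '' {i}ᶜ) ?_ ?_ ?_
    · rintro _ ⟨j, -, rfl⟩
      exact hp j
    · rintro ⟨j, hj, hji⟩
      exact hj (hinj hji)
    · rw [Set.image_image]
      exact h
  obtain ⟨σ, hne, hσ⟩ := exists_algEquiv_ne_of_notMem_adjoin _ hi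
  refine ⟨σ.toRingEquiv, ?_, fun j hj => hσ _ ⟨j, hj, rfl⟩⟩
  have h2 : σ (sqrtElem p i) ^ 2 = sqrtElem p i ^ 2 := by
    rw [← map_pow, sqrtElem_sq, map_natCast]
  exact (sq_eq_sq_iff_eq_or_eq_neg.1 h2).resolve_left hne

/-- Ring automorphisms fix ℚ automatically, so they are determined on generators. This later makes
pointwise chosen automorphisms a homomorphism. -/
theorem ringAut_sqrtField_ext {σ τ : RingAut (SqrtField p)}
    (h : ∀ j, σ (sqrtElem p j) = τ (sqrtElem p j)) : σ = τ := by
  let f : RingAut (SqrtField p) → (SqrtField p →ₐ[ℚ] SqrtField p) := fun σ =>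
    { σ.toRingHom with commutes' := fun r => map_ratCast σ r }
  have : f σ = f τ := by
    refine adjoin_algHom_ext ℚ fun x hx => ?_
    obtain ⟨j, rfl⟩ := hx
    exact h j
  exact RingEquiv.ext fun x => DFunLike.congr_fun this x

/-- The sign `(-1) ^ x j` as an element of the multiquadratic field. -/
noncomputable def sqrtSign (p : ℕ → ℕ) (x : LexSum) (j : ℕ) : SqrtField p :=
  (((ofLex x j).negOnePow : ℤ) : SqrtField p)

theorem sqrtSign_add (x y : LexSum) (j : ℕ) :
    sqrtSign p (x + y) j = sqrtSign p x j * sqrtSign p y j := by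
  simp [sqrtSign, Int.negOnePow_add]

theorem sqrtSign_lexGen (i j : ℕ) : sqrtSign p (lexGen i) j = if j = i then -1 else 1 := by
  rw [sqrtSign, lexGen, ofLex_toLex, Finsupp.single_apply]
  by_cases h : j = i
  · simp [h]
  · simp [h, Ne.symm h]

theorem map_sqrtSign (σ : RingAut (SqrtField p)) (x : LexSum) (j : ℕ) :
    σ (sqrtSign p x j) = sqrtSign p x j := map_intCast σ _

theorem exists_ringAut_sqrtElem (hp : ∀ i, (p i).Prime) (hinj : Function.Injective p)
    (x : LexSum) : ∃ σ : RingAut (SqrtField p), ∀ j,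
      σ (sqrtElem p j) = sqrtSign p x j * sqrtElem p j := by
  have hadd : ∀ x y : LexSum,
      (∃ σ : RingAut (SqrtField p), ∀ j, σ (sqrtElem p j) = sqrtSign p x j * sqrtElem p j) →
      (∃ σ : RingAut (SqrtField p), ∀ j, σ (sqrtElem p j) = sqrtSign p y j * sqrtElem p j) →
      ∃ σ : RingAut (SqrtField p), ∀ j,
        σ (sqrtElem p j) = sqrtSign p (x + y) j * sqrtElem p j := by
    rintro x y ⟨σ, hσ⟩ ⟨τ, hτ⟩
    refine ⟨σ * τ, fun j => ?_⟩
    rw [RingAut.mul_apply, hτ, map_mul, map_sqrtSign, hσ, sqrtSign_add]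
    ring
  change (fun x : ℕ →₀ ℤ => ∃ σ : RingAut (SqrtField p), ∀ j,
      σ (sqrtElem p j) = sqrtSign p (toLex x) j * sqrtElem p j) (ofLex x)
  induction ofLex x using Finsupp.induction_linear with
  | zero => exact ⟨1, fun j => by simp [sqrtSign]⟩
  | add x y hx hy => exact hadd _ _ hx hy
  | single i n =>
    obtain ⟨σ, hσ, hσ'⟩ := exists_ringAut_sqrtElem_single hp hinj i
    -- The signs depend only on the parity of `n`, so the identity or the single sign change
    -- suffices.
    rcases Int.even_or_odd n with hn | hn
    · refine ⟨1, fun j => ?_⟩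
      by_cases h : i = j <;> simp [sqrtSign, h, Int.negOnePow_even _ hn]
    · refine ⟨σ, fun j => ?_⟩
      by_cases h : i = j
      · subst h
        simp [sqrtSign, Int.negOnePow_odd _ hn, hσ]
      · simp [sqrtSign, h, hσ' j (Ne.symm h)]

/-- The direct sum acts on the multiquadratic field by sign changes. -/
theorem exists_signAction (hp : ∀ i, (p i).Prime) (hinj : Function.Injective p) :
    ∃ Φ : Multiplicative LexSum →* RingAut (SqrtField p), ∀ x j,
      Φ (Multiplicative.ofAdd x) (sqrtElem p j) = sqrtSign p x j * sqrtElem p j := by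
  choose σ hσ using exists_ringAut_sqrtElem hp hinj
  refine ⟨MonoidHom.mk' (fun x : Multiplicative LexSum => σ x.toAdd)
    fun x y => ringAut_sqrtField_ext fun j => ?_,
    fun x j => hσ x j⟩
  rw [RingAut.mul_apply, hσ, hσ, _root_.map_mul (σ _), map_sqrtSign, hσ, toAdd_mul,
    sqrtSign_add]
  ring

end MultiquadraticField

/-! ### Monomials and 0-1 series in the Malcev–Neumann ring -/

namespace MalcevNeumann

variable {Γ K : Type*} [AddCommGroup Γ] [LinearOrder Γ]

section Ring

variable [Ring K] {Φ : Multiplicative Γ →* RingAut K}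

theorem single_injective_left {x y : Γ} {c d : K} (hc : c ≠ 0)
    (h : (single x c : MalcevNeumann Φ) = single y d) : x = y := by
  by_contra hxy
  have := congrArg (fun a => a.coeff x) h
  simp only [coeff_single, if_neg hxy, if_true] at this
  exact hc this

theorem single_ne_zero {x : Γ} {c : K} (hc : c ≠ 0) : (single x c : MalcevNeumann Φ) ≠ 0 := by
  intro h
  have := congrArg (fun a => a.coeff x) h
  simp only [coeff_single, if_true, coeff_zero] at this
  exact hc this

theorem neg_single (x : Γ) (c : K) : -(single x c : MalcevNeumann Φ) = single x (-c) := by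
  classical
  ext z
  rw [coeff_neg, coeff_single, coeff_single]
  split_ifs <;> simp

/-- The formal sum of the elements of a well-ordered set. -/
noncomputable def indicator (s : Set Γ) (hs : s.IsWF) : MalcevNeumann Φ :=
  ⟨s.indicator fun _ => 1, hs.mono (Set.support_indicator_subset)⟩

theorem coeff_indicator (s : Set Γ) (hs : s.IsWF) (x : Γ) :
    (indicator s hs : MalcevNeumann Φ).coeff x = s.indicator (fun _ => 1) x := rfl

variable [IsOrderedAddMonoid Γ]

theorem single_mul_single (x y : Γ) (c d : K) :
    (single x c * single y d : MalcevNeumann Φ) =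
      single (x + y) (c * Φ (Multiplicative.ofAdd x) d) := by
  classical
  ext z
  rw [coeff_single_mul, coeff_single, coeff_single]
  by_cases h : z = x + y
  · rw [if_pos h, if_pos (sub_eq_iff_eq_add'.2 h)]
  · rw [if_neg h, if_neg fun h' => h (sub_eq_iff_eq_add'.1 h'), map_zero, mul_zero]

/-- The coefficients 0 and 1 are fixed by every automorphism, so the twist is invisible and
commutativity of `Γ` suffices. -/
theorem commute_single_one_indicator (x : Γ) (s : Set Γ) (hs : s.IsWF) :
    Commute (indicator s hs : MalcevNeumann Φ) (single x 1) := by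
  classical
  ext z
  rw [coeff_single_mul, coeff_mul_single, coeff_indicator, Set.indicator_apply]
  split_ifs <;> simp

end Ring

section CommRing

variable [CommRing K] {Φ : Multiplicative Γ →* RingAut K} [IsOrderedAddMonoid Γ]

theorem single_mem_center {x : Γ} {c : K} (hx : Φ (Multiplicative.ofAdd x) = 1)
    (hc : ∀ y, Φ (Multiplicative.ofAdd y) c = c) :
    (single x c : MalcevNeumann Φ) ∈ Subring.center (MalcevNeumann Φ) := by
  rw [Subring.mem_center_iff]
  intro a
  ext z
  rw [coeff_mul_single, coeff_single_mul, hc, hx, RingAut.one_apply, mul_comm]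

theorem commute_single_zero_indicator {c : K} {s : Set Γ} (hs : s.IsWF)
    (h : ∀ x ∈ s, Φ (Multiplicative.ofAdd x) c = c) :
    Commute (indicator s hs : MalcevNeumann Φ) (single 0 c) := by
  classical
  ext z
  rw [coeff_single_mul, coeff_mul_single, sub_zero, coeff_indicator, Set.indicator_apply,
    ofAdd_zero, map_one, RingAut.one_apply]
  split_ifs with hz
  · rw [h z hz, mul_comm]
  · simp

end CommRing

end MalcevNeumann

theorem lexGen_strictAnti : StrictAnti lexGen := by
  intro i j hij
  refine (Finsupp.Lex.lt_iff).2 ⟨i, fun k hk => ?_, ?_⟩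
  · simp [lexGen, hk.ne', (hk.trans hij).ne']
  · simp [lexGen, hij.ne']

/-- The generators decrease, so their negatives increase with the index; hence ∑ x_i⁻¹ is an
admissible series. -/
theorem isWF_neg_lexGen (n : ℕ) : ((fun i => -lexGen i) '' Set.Ici n).IsWF := by
  have hmono : Monotone fun i => -lexGen i := fun i j h => neg_le_neg (lexGen_strictAnti.antitone h)
  exact ((Set.isPWO_of_wellQuasiOrderedLE (Set.Ici n)).image_of_monotone hmono).isWF

/-! ### The tower inside the Malcev–Neumann division ring -/

section Construction

open MalcevNeumann

variable {p : ℕ → ℕ} {Φ : Multiplicative LexSum →* RingAut (SqrtField p)}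

theorem sqrtElem_ne_zero (hp : ∀ i, (p i).Prime) (i : ℕ) : sqrtElem p i ≠ 0 := fun h =>
  (Real.sqrt_pos.2 (Nat.cast_pos.2 (hp i).pos)).ne' (congrArg Subtype.val h)

theorem signAction_add_self
    (hΦ : ∀ x j, Φ (Multiplicative.ofAdd x) (sqrtElem p j) = sqrtSign p x j * sqrtElem p j)
    (x : LexSum) : Φ (Multiplicative.ofAdd (x + x)) = 1 := by
  refine ringAut_sqrtField_ext fun j => ?_
  rw [hΦ, RingAut.one_apply, sqrtSign, ofLex_add, Finsupp.add_apply,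
    Int.negOnePow_even _ (Even.add_self _)]
  simp

theorem signAction_lexGen
    (hΦ : ∀ x j, Φ (Multiplicative.ofAdd x) (sqrtElem p j) = sqrtSign p x j * sqrtElem p j)
    (i j : ℕ) : Φ (Multiplicative.ofAdd (lexGen i)) (sqrtElem p j) =
      if j = i then -sqrtElem p j else sqrtElem p j := by
  rw [hΦ, sqrtSign_lexGen]
  split_ifs <;> simp

theorem signAction_neg_lexGen
    (hΦ : ∀ x j, Φ (Multiplicative.ofAdd x) (sqrtElem p j) = sqrtSign p x j * sqrtElem p j)
    {i j : ℕ} (hij : j ≠ i) :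
    Φ (Multiplicative.ofAdd (-lexGen i)) (sqrtElem p j) = sqrtElem p j := by
  rw [ofAdd_neg, map_inv, RingAut.inv_apply, RingEquiv.symm_apply_eq, signAction_lexGen hΦ,
    if_neg hij]

/-- The tails of the series `∑ x_i⁻¹`. -/
noncomputable def tailSeries (Φ : Multiplicative LexSum →* RingAut (SqrtField p)) (n : ℕ) :
    MalcevNeumann Φ :=
  indicator _ (isWF_neg_lexGen n)

theorem inv_single_lexGen (n : ℕ) :
    (single (lexGen n) 1 : MalcevNeumann Φ)⁻¹ = single (-lexGen n) 1 := by
  refine inv_eq_of_mul_eq_one_right ?_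
  rw [single_mul_single, add_neg_cancel, map_one, mul_one, one_def]

theorem tailSeries_succ (n : ℕ) :
    tailSeries Φ n = tailSeries Φ (n + 1) + (single (lexGen n) 1)⁻¹ := by
  classical
  rw [inv_single_lexGen]
  ext z
  have hset : z ∈ (fun i => -lexGen i) '' Set.Ici n ↔
      z = -lexGen n ∨ z ∈ (fun i => -lexGen i) '' Set.Ici (n + 1) := by
    rw [← Set.mem_insert_iff, ← Set.image_insert_eq (f := fun i => -lexGen i)]
    rw [← Order.succ_eq_add_one, Order.Ici_succ, Set.Ioi_insert]
  have hn : -lexGen n ∉ (fun i => -lexGen i) '' Set.Ici (n + 1) := by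
    rintro ⟨i, hi, h⟩
    exact (Nat.lt_of_succ_le hi).ne' (lexGen_strictAnti.injective (neg_injective h))
  rw [coeff_add, tailSeries, tailSeries, coeff_indicator, coeff_indicator, coeff_single,
    Set.indicator_apply, Set.indicator_apply]
  by_cases h : z = -lexGen n
  · subst h
    simp [hset, hn]
  · simp [hset, h]

/-- The division subring generated by the `x_i`, the `√pᵢ` and `∑ x_i⁻¹`. -/
noncomputable def towerSubfield (Φ : Multiplicative LexSum →* RingAut (SqrtField p)) :
    Subfield (MalcevNeumann Φ) :=
  Subfield.closure (Set.range (fun i => single (lexGen i) 1) ∪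
    Set.range (fun i => single 0 (sqrtElem p i)) ∪ {tailSeries Φ 0})

theorem single_lexGen_mem (i : ℕ) : single (lexGen i) 1 ∈ towerSubfield Φ :=
  Subfield.subset_closure (Or.inl (Or.inl ⟨i, rfl⟩))

theorem single_sqrtElem_mem (i : ℕ) : single 0 (sqrtElem p i) ∈ towerSubfield Φ :=
  Subfield.subset_closure (Or.inl (Or.inr ⟨i, rfl⟩))

theorem tailSeries_mem (n : ℕ) : tailSeries Φ n ∈ towerSubfield Φ := by
  induction n with
  | zero => exact Subfield.subset_closure (Or.inr rfl)
  | succ n ih =>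
    rw [eq_sub_iff_add_eq.2 (tailSeries_succ (Φ := Φ) n).symm]
    exact sub_mem ih (inv_mem (single_lexGen_mem n))

theorem Subfield.coe_mem_center_of_mem_center {D : Type*} [DivisionRing D] {E : Subfield D} {x : E}
    (hx : (x : D) ∈ Subring.center D) : x ∈ Subring.center E :=
  Subring.mem_center_iff.2 fun y => Subtype.ext (Subring.mem_center_iff.1 hx y)

theorem isQuaternionTower_towerSubfield (hp : ∀ i, (p i).Prime)
    (hΦ : ∀ x j, Φ (Multiplicative.ofAdd x) (sqrtElem p j) = sqrtSign p x j * sqrtElem p j) :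
    IsQuaternionTower (R := towerSubfield Φ) (fun i => ⟨_, single_lexGen_mem i⟩)
      (fun i => ⟨_, single_sqrtElem_mem i⟩) (fun n => ⟨_, tailSeries_mem n⟩) where
  two_ne_zero h := by
    have h1 := congrArg (fun x : towerSubfield Φ => (x : MalcevNeumann Φ).coeff 0) h
    have h2 : (((2 : towerSubfield Φ) : MalcevNeumann Φ)) = 1 + 1 := one_add_one_eq_two.symm
    simp only [h2, coeff_add, one_def, coeff_single, if_true, ZeroMemClass.coe_zero,
      coeff_zero] at h1
    norm_num at h1
  u_injective i j h := lexGen_strictAnti.injective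
    (single_injective_left one_ne_zero (congrArg Subtype.val h))
  u_ne_zero i h := single_ne_zero one_ne_zero (congrArg Subtype.val h)
  u_sq i := Subfield.coe_mem_center_of_mem_center (by
    rw [MulMemClass.coe_mul, single_mul_single, map_one, mul_one]
    exact single_mem_center (signAction_add_self hΦ _) fun _ => map_one _)
  s_ne_zero i h := single_ne_zero (sqrtElem_ne_zero hp i) (congrArg Subtype.val h)
  s_sq i := Subfield.coe_mem_center_of_mem_center (by
    rw [MulMemClass.coe_mul, single_mul_single, ofAdd_zero, map_one, RingAut.one_apply, ← sq,
      sqrtElem_sq, add_zero]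
    exact single_mem_center (by rw [ofAdd_zero, map_one]) fun _ => map_natCast _ _)
  u_comm i j := Subtype.ext (by
    simp only [MulMemClass.coe_mul, single_mul_single, map_one, add_comm])
  s_comm i j := Subtype.ext (by
    simp only [MulMemClass.coe_mul, single_mul_single, ofAdd_zero, map_one, RingAut.one_apply,
      mul_comm])
  u_s i j hij := Subtype.ext (by
    simp only [MulMemClass.coe_mul, single_mul_single, ofAdd_zero, map_one, signAction_lexGen hΦ,
      if_neg hij.symm, add_zero, zero_add, mul_one, one_mul])
  u_s_self i := Subtype.ext (by
    simp only [MulMemClass.coe_mul, NegMemClass.coe_neg, single_mul_single, map_one,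
      signAction_lexGen hΦ, if_true, add_zero, zero_add, mul_one, one_mul, neg_single])
  t_u n i := Subtype.ext (commute_single_one_indicator _ _ (isWF_neg_lexGen n))
  t_s n i hi := Subtype.ext (commute_single_zero_indicator (isWF_neg_lexGen n) (by
    rintro _ ⟨j, hj, rfl⟩
    -- Every index j in the tail satisfies j ≥ n > i, so x_j⁻¹ fixes √p_i.
    exact signAction_neg_lexGen hΦ (hi.trans_le hj).ne))
  t_succ n := Subtype.ext (tailSeries_succ n)
  closure_eq_top := by
    rw [eq_top_iff]
    rintro ⟨x, hx⟩ -
    set X : Set (towerSubfield Φ) := Set.range (fun i => ⟨_, single_lexGen_mem i⟩) ∪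
      Set.range (fun i => ⟨_, single_sqrtElem_mem i⟩) ∪ {⟨_, tailSeries_mem 0⟩}
    -- Generation must hold inside the subring itself, so its internal closure is compared with the
    -- ambient one through the inclusion.
    have hle : towerSubfield Φ ≤ (Subfield.closure X).map (towerSubfield Φ).subtype := by
      refine Subfield.closure_le.2 ?_
      rintro _ ((⟨i, rfl⟩ | ⟨i, rfl⟩) | rfl)
      · exact ⟨⟨_, single_lexGen_mem i⟩, Subfield.subset_closure (Or.inl (Or.inl ⟨i, rfl⟩)), rfl⟩
      · exact ⟨⟨_, single_sqrtElem_mem i⟩, Subfield.subset_closure (Or.inl (Or.inr ⟨i, rfl⟩)), rfl⟩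
      · exact ⟨⟨_, tailSeries_mem 0⟩, Subfield.subset_closure (Or.inr rfl), rfl⟩
    obtain ⟨y, hy, hyx⟩ := hle hx
    exact (Subtype.ext hyx : y = ⟨x, hx⟩) ▸ hy

end Construction

theorem theorem3p1 (p : ℕ → ℕ) (hp : ∀ i, (p i).Prime) (hmono : StrictMono p) :
    ∃ Φ : Multiplicative LexSum →* RingAut (SqrtField p),
      (∀ i j, Φ (Multiplicative.ofAdd (lexGen i)) (sqrtElem p j) =
        if j = i then -sqrtElem p j else sqrtElem p j) ∧
      ∃ R : Subfield (MalcevNeumann Φ),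
        IsWeaklyLocallyFinite R ∧ divisionRingGKDim R = 1 ∧
          ¬ Algebra.IsAlgebraic (Subring.center R) R := by
  obtain ⟨Φ, hΦ⟩ := exists_signAction hp hmono.injective
  have h := isQuaternionTower_towerSubfield hp hΦ
  exact ⟨Φ, signAction_lexGen hΦ, towerSubfield Φ, h.isWeaklyLocallyFinite,
    h.divisionRingGKDim_eq_one, h.not_isAlgebraic⟩
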